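/- **Setting.** Let $n\ge 2$, $m\ge 1$, and let $\Omega\subset\mathbb R^n$ be a bounded domain with $C^2$ boundary whose mean curvature with respect to the inner normal is nonnegative. Put $d(x)=\operatorname{dist}(x,\partial\Omega)$, $\Omega_s=\{x\in\Omega: d(x)>s\}$, $\Omega_s^*=\{x\in\Omega: d(x)<s\}$. Let $l<\infty$ be an upper bound for the intrinsic diameter of $\Omega$ (the supremum over $x,y\in\Omega$ of the infimum of the lengths of curves in $\Omega$ joining $x$ to $y$; for convex $\Omega$ this is the usual diameter). Let $\psi=(\psi^1,\dots,\psi^m)\in C^2(\overline\Omega,\mathbb R^m)$, $\varphi=\psi^m$, $|D\varphi|_0=\sup_\Omega|D\varphi|$. **Constants.** For $d_0>0$ let $$\lambda_-(d)=\max\{0,-\inf_{\Omega^*_{d_0}}\lambda_{\min}(D^2d)\},\qquad \lambda_+(\pm\varphi)=\max\{0,\sup_{\Omega^*_{d_0}}\lambda_{\max}(\pm D^2\varphi)\},$$ $$\nu=16n\big(\max\{\lambda_+(\varphi),\lambda_+(-\varphi)\}+1\big),\qquad \kappa=e^{\nu|D\varphi|_0l},$$ where $\lambda_{\min},\lambda_{\max}$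 are the smallest and largest eigenvalues. Assume that $d\in C^2(\overline{\Omega^*_{d_0}})$ and $$\frac1{d_0}\ge\max\Big\{\big(64(1+|D\varphi|_0)^2\kappa^2+8n\big)\lambda_-(d),\ 2n\nu(1+|D\varphi|_0)\Big\}.$$ **(a) Elliptic estimate.** Let $u=(u^1,\dots,u^m)\in C^2(\Omega)\cap C^0(\overline\Omega)$ satisfy $g^{ij}u^\alpha_{ij}=0$ in $\Omega$ and $u^\alpha=\psi^\alpha$ on $\partial\Omega$ for $\alpha=1,\dots,m$, where $(g^{ij})$ is the inverse of $g_{ij}=\delta_{ij}+\sum_\alpha u^\alpha_iu^\alpha_j$. Suppose that the $n$ singular values $\lambda_1,\dots,\lambda_n$ of $Du$ satisfy $\lambda_i\lambda_j\le1$ on $\Omega$ for $i\ne j$, that $|Du^\alpha|\le\frac{n-1}{m-1}$ on $\Omega_{d_0/\kappa}$ for $\alpha=1,\dots,m-1$, and that $\det(g_{ij})\le\frac{2\kappa^2}{d_0^2\nu^2}$ on $\Omega$. Then $$|Du^m(x)|\le\frac{\kappa}{d_0\nu}+|D\varphi|_0$$ at every $x\in\partial\Omega$ at which $u^m$ is differentiable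 relative to $\overline\Omega$ (so at every $x\in\partial\Omega$ if $u\in C^1(\overline\Omega)$). **(b) Parabolic estimate.** Let $f=(f^1,\dots,f^m)$ be continuous on $\overline\Omega\times[0,T)$, $C^2$ in $x\in\Omega$ for each $t\in(0,T)$, and satisfy $\partial_tf^\alpha=g^{ij}f^\alpha_{ij}$ in $\Omega\times(0,T)$ with $g_{ij}=\delta_{ij}+\sum_\alpha f^\alpha_if^\alpha_j$, $f(\cdot,0)=\psi$ in $\Omega$, and $f(\cdot,t)=\psi$ on $\partial\Omega$ for $t\in[0,T)$. Suppose that for every $t\in[0,T)$ the products of two distinct singular values of $Df(\cdot,t)$ are at most $1$ on $\Omega$, $|Df^\alpha(\cdot,t)|\le\frac{n-1}{m-1}$ on $\Omega_{d_0/\kappa}$ for $\alpha=1,\dots,m-1$, and $\det(g_{ij})\le\frac{2\kappa^2}{d_0^2\nu^2}$ on $\Omega$. Then for every $t\in[0,T)$ $$|Df^m(x,t)|\le\frac{\kappa}{d_0\nu}+|D\varphi|_0$$ at every $x\in\partial\Omega$ at which $f^m(\cdot,t)$ is differentiable relative to $\overline\Omega$. -/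

import Mathlib

open Set Filter Topology
open scoped ENNReal Matrix

noncomputable section

namespace MinimalGraph

/-- Euclidean space `ℝⁿ`. -/
abbrev E (n : ℕ) : Type := EuclideanSpace ℝ (Fin n)

/-! ### Derivatives in coordinates -/

/-- The partial derivative `∂ᵢ f (x)`. -/
def pderiv {n : ℕ} (i : Fin n) (f : E n → ℝ) (x : E n) : ℝ :=
  fderiv ℝ f x (EuclideanSpace.single i 1)

/-- The Hessian matrix `(∂ᵢ ∂ⱼ f (x))`. -/
def hessian {n : ℕ} (f : E n → ℝ) (x : E n) : Matrix (Fin n) (Fin n) ℝ :=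
  Matrix.of fun i j => pderiv i (pderiv j f) x

/-- The largest eigenvalue of the Hessian of `f` at `x`. -/
def lamMax {n : ℕ} (f : E n → ℝ) (x : E n) : ℝ := sSup (spectrum ℝ (hessian f x))

/-- The smallest eigenvalue of the Hessian of `f` at `x`. -/
def lamMin {n : ℕ} (f : E n → ℝ) (x : E n) : ℝ := sInf (spectrum ℝ (hessian f x))

/-! ### The minimal surface system -/

/-- The metric `g_ij = δ_ij + ∑_α ∂ᵢu^α ∂ⱼu^α` induced on the graph of `u`. -/
def metric {n m : ℕ} (u : E n → E m) (x : E n) : Matrix (Fin n) (Fin n) ℝ :=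
  Matrix.of fun i j => (if i = j then 1 else 0) +
    ∑ α, pderiv i (fun y => u y α) x * pderiv j (fun y => u y α) x

/-- The quantity `g^{ij} ∂ᵢ∂ⱼ u^α` at `x`, where `(g^{ij})` is the inverse of the induced metric. -/
def graphOperator {n m : ℕ} (u : E n → E m) (α : Fin m) (x : E n) : ℝ :=
  ∑ i, ∑ j, (metric u x)⁻¹ i j * hessian (fun y => u y α) x i j

/-- All products `λᵢ(x) λⱼ(x)`, `i ≠ j`, of two of the `n` singular values (with multiplicity) of
`du(x)` are at most one, for every `x ∈ Ω`. -/
def AreaDecreasing {n m : ℕ} (Ω : Set (E n)) (u : E n → E m) : Prop :=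
  ∀ x ∈ Ω, ∀ i j : Fin n, i ≠ j →
    (fderiv ℝ u x).toLinearMap.singularValues i * (fderiv ℝ u x).toLinearMap.singularValues j ≤ 1

/-- `u ∈ C²(Ω) ∩ C⁰(closure Ω)` solves the Dirichlet problem for the minimal surface system:
`g^{ij} u^α_{ij} = 0` in `Ω`, `u = ψ` on the boundary. -/
structure IsMinimalGraph {n m : ℕ} (Ω : Set (E n)) (ψ u : E n → E m) : Prop where
  continuousOn : ContinuousOn u (closure Ω)
  contDiffOn : ContDiffOn ℝ 2 u Ω
  equation : ∀ x ∈ Ω, ∀ α, graphOperator u α x = 0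
  boundary : ∀ x ∈ frontier Ω, u x = ψ x

/-- `f` solves `∂ₜ f^α = g^{ij} f^α_{ij}` in `Ω × (0,T)` with initial and boundary values `ψ`. -/
structure IsGraphFlow {n m : ℕ} (Ω : Set (E n)) (T : ℝ) (ψ : E n → E m) (f : ℝ → E n → E m) :
    Prop where
  continuousOn : ContinuousOn (fun p : ℝ × E n => f p.1 p.2) (Ico 0 T ×ˢ closure Ω)
  contDiffOn : ∀ t ∈ Ioo 0 T, ContDiffOn ℝ 2 (f t) Ω
  equation : ∀ t ∈ Ioo 0 T, ∀ x ∈ Ω, ∀ α,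
    HasDerivAt (fun s => f s x α) (graphOperator (f t) α x) t
  initial : ∀ x ∈ Ω, f 0 x = ψ x
  boundary : ∀ t ∈ Ico 0 T, ∀ x ∈ frontier Ω, f t x = ψ x

/-! ### Geometry of the domain -/

/-- The distance `d(x) = d(x, ∂Ω)`. -/
def bdist {n : ℕ} (Ω : Set (E n)) (x : E n) : ℝ := Metric.infDist x (frontier Ω)

/-- The collar `{x ∈ Ω | d(x) < s}`. -/
def collar {n : ℕ} (Ω : Set (E n)) (s : ℝ) : Set (E n) := {x ∈ Ω | bdist Ω x < s}

/-- The inner domain `{x ∈ Ω | d(x) > s}`. -/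
def innerPart {n : ℕ} (Ω : Set (E n)) (s : ℝ) : Set (E n) := {x ∈ Ω | s < bdist Ω x}

/-- `ρ` is a `C²` function on the open set `U ∋ p` without critical points, and
`Ω ∩ U = {ρ > 0}`. -/
structure IsLocalDefiningFunction {n : ℕ} (Ω U : Set (E n)) (ρ : E n → ℝ) (p : E n) : Prop where
  isOpen : IsOpen U
  mem : p ∈ U
  contDiffOn : ContDiffOn ℝ 2 ρ U
  regular : ∀ x ∈ U, fderiv ℝ ρ x ≠ 0
  mem_iff : ∀ x ∈ U, (x ∈ Ω ↔ 0 < ρ x)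

/-- The boundary of `Ω` is of class `C²`, with `Ω` locally on one side of it. -/
def HasC2Boundary {n : ℕ} (Ω : Set (E n)) : Prop :=
  ∀ p ∈ frontier Ω, ∃ U ρ, IsLocalDefiningFunction Ω U ρ p

/-- The mean curvature (sum of the principal curvatures) `-div (Dρ / |Dρ|)` of the level set of `ρ`
through `p` with respect to the normal `Dρ / |Dρ|`. For a local defining function of `Ω` this normal
points into `Ω`; the sign is such that the boundary of a ball has positive mean curvature. -/
def levelMeanCurvature {n : ℕ} (ρ : E n → ℝ) (p : E n) : ℝ :=
  -∑ i, pderiv i (fun y => pderiv i ρ y / ‖fderiv ℝ ρ y‖) p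

/-- The mean curvature of `∂Ω` with respect to the inner normal is nonnegative. -/
def MeanConvex {n : ℕ} (Ω : Set (E n)) : Prop :=
  ∀ p ∈ frontier Ω, ∀ U ρ, IsLocalDefiningFunction Ω U ρ p → 0 ≤ levelMeanCurvature ρ p

/-- The infimum of the lengths of the continuous curves in `Ω` from `x` to `y`. -/
def intrinsicEDist {n : ℕ} (Ω : Set (E n)) (x y : E n) : ℝ≥0∞ :=
  ⨅ (γ : ℝ → E n) (_ : ContinuousOn γ (Icc 0 1) ∧ MapsTo γ (Icc 0 1) Ω ∧ γ 0 = x ∧ γ 1 = y),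
    eVariationOn γ (Icc 0 1)

/-- The diameter of `Ω` in its intrinsic (path length) distance. -/
def intrinsicDiam {n : ℕ} (Ω : Set (E n)) : ℝ≥0∞ := ⨆ x ∈ Ω, ⨆ y ∈ Ω, intrinsicEDist Ω x y

/-! ### The constants of the estimate -/

/-- `|Dφ|₀ = sup_Ω |Dφ|`. -/
def gradSup {n : ℕ} (Ω : Set (E n)) (φ : E n → ℝ) : ℝ := sSup ((fun x => ‖fderiv ℝ φ x‖) '' Ω)

/-- `λ₊(φ)`: the positive part of the supremum over the collar of width `d₀` of the largest
eigenvalue of `D²φ`. -/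
def lamPlus {n : ℕ} (Ω : Set (E n)) (d₀ : ℝ) (φ : E n → ℝ) : ℝ :=
  max 0 (sSup (lamMax φ '' collar Ω d₀))

/-- `λ₋(d)`: the negative part of the infimum over the collar of width `d₀` of the smallest
eigenvalue of `D²d`. -/
def lamMinus {n : ℕ} (Ω : Set (E n)) (d₀ : ℝ) : ℝ :=
  max 0 (-sInf (lamMin (bdist Ω) '' collar Ω d₀))

/-- `ν = 16 n (max (λ₊(φ), λ₊(-φ)) + 1)`. -/
def nu {n : ℕ} (Ω : Set (E n)) (d₀ : ℝ) (φ : E n → ℝ) : ℝ :=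
  16 * n * (max (lamPlus Ω d₀ φ) (lamPlus Ω d₀ (fun x => -φ x)) + 1)

/-- `κ = exp (ν |Dφ|₀ l)`. -/
def kappa {n : ℕ} (Ω : Set (E n)) (l d₀ : ℝ) (φ : E n → ℝ) : ℝ :=
  Real.exp (nu Ω d₀ φ * gradSup Ω φ * l)

/-- The last component of a vector valued function. -/
def lastComp {n k : ℕ} (ψ : E n → E (k + 1)) (x : E n) : ℝ := ψ x (Fin.last k)

end MinimalGraph

end

open MinimalGraph

/-! The proof is a barrier argument. Write φ = ψ^m, K = |Dφ|₀, σ = ±1, and in the collar d ≤ d₀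
compare σu^m with b = v(d) + σφ, where v(s) = ν⁻¹ log(1 + κs/d₀). If σu^m ≤ b for both signs, then
|u^m - φ| ≤ v(d) ≤ v'(0) d with v'(0) = κ/(d₀ν). This bounds the derivative of u^m - φ at the
boundary, and Dφ contributes the remaining K.

On ∂Ω the comparison holds because v ≥ 0. On d = d₀ the maximum principle bounds σ(u^m - φ) by the
oscillation of φ, hence by Kl, and κ is chosen so that v(d₀) ≥ Kl. At an interior maximum of σu^m -
b one would have g^{ij}b_ij ≥ 0, which `metricTrace_barrier_neg` excludes for the following reasons.

Mean convexity makes d superharmonic: in directions tangential to the level sets, D²d is at most the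
normalized Hessian of a defining function at the nearest boundary point (`D2_bdist_le`). The area
decreasing condition turns this into g^{ij}d_ij ≤ (n+1) λ₋ q with q = g^{ij}d_i d_j
(`sum_inv_mul_bilin_le`). Since v'' = -νv'², the concavity of v contributes -νv'²q. Half of it
absorbs v' g^{ij}d_ij, and the other half absorbs the Hessian of φ as soon as q ≥ 1/(8v'²), that is,
as soon as all 1 + λ_i² ≤ 8v'². For d ≤ d₀/κ that bound follows from the bound on det g. Farther in,
the gradients of the other components are controlled by hypothesis, while Du^m is controlled by the
touching itself: σDu^m = Db there, so |Du^m| ≤ v' + K.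

`IsWeakFlow` treats both estimates at once, with maxima taken over a compact time interval that is a
single instant in the elliptic case. -/

namespace MinimalGraph

/-! ### Second derivatives -/

/-- The second derivative as a bilinear form. -/
noncomputable abbrev D2 {n : ℕ} (f : E n → ℝ) (x : E n) : E n →L[ℝ] E n →L[ℝ] ℝ :=
  fderiv ℝ (fderiv ℝ f) x

section Calculus

variable {n : ℕ} {f g : E n → ℝ} {x : E n}

theorem differentiableAt_fderiv (hf : ContDiffAt ℝ 2 f x) :
    DifferentiableAt ℝ (fderiv ℝ f) x :=
  (hf.fderiv_right (m := 1) (by norm_num)).differentiableAt (by norm_num)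

theorem eventually_differentiableAt (hf : ContDiffAt ℝ 2 f x) :
    ∀ᶠ y in 𝓝 x, DifferentiableAt ℝ f y := by
  filter_upwards [hf.eventually (by simp)] with y hy
  exact hy.differentiableAt (by norm_num)

theorem hessian_eq (hf : ContDiffAt ℝ 2 f x) (i j : Fin n) :
    hessian f x i j = D2 f x (EuclideanSpace.single i 1) (EuclideanSpace.single j 1) := by
  have h := (differentiableAt_fderiv hf).hasFDerivAt.clm_apply
    (hasFDerivAt_const (EuclideanSpace.single j (1 : ℝ)) x)
  simp only [hessian, pderiv, Matrix.of_apply]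
  erw [h.fderiv]
  simp

theorem D2_symm (hf : ContDiffAt ℝ 2 f x) (v w : E n) : D2 f x v w = D2 f x w v :=
  (hf.isSymmSndFDerivAt (by simp)).eq v w

theorem D2_add (hf : ContDiffAt ℝ 2 f x) (hg : ContDiffAt ℝ 2 g x) :
    D2 (fun y => f y + g y) x = D2 f x + D2 g x := by
  have : fderiv ℝ (fun y => f y + g y) =ᶠ[𝓝 x] fun y => fderiv ℝ f y + fderiv ℝ g y := by
    filter_upwards [eventually_differentiableAt hf, eventually_differentiableAt hg] with y h1 h2
    exact fderiv_fun_add h1 h2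
  rw [D2, this.fderiv_eq]
  exact fderiv_fun_add (differentiableAt_fderiv hf) (differentiableAt_fderiv hg)

theorem D2_const_mul (c : ℝ) (hf : ContDiffAt ℝ 2 f x) :
    D2 (fun y => c * f y) x = c • D2 f x := by
  have : fderiv ℝ (fun y => c * f y) =ᶠ[𝓝 x] fun y => c • fderiv ℝ f y := by
    filter_upwards [eventually_differentiableAt hf] with y h1
    exact fderiv_const_mul h1 c
  rw [D2, this.fderiv_eq]
  exact fderiv_fun_const_smul (differentiableAt_fderiv hf) c

theorem D2_sub (hf : ContDiffAt ℝ 2 f x) (hg : ContDiffAt ℝ 2 g x) :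
    D2 (fun y => f y - g y) x = D2 f x - D2 g x := by
  have : fderiv ℝ (fun y => f y - g y) =ᶠ[𝓝 x] fun y => fderiv ℝ f y - fderiv ℝ g y := by
    filter_upwards [eventually_differentiableAt hf, eventually_differentiableAt hg] with y h1 h2
    exact fderiv_fun_sub h1 h2
  rw [D2, this.fderiv_eq]
  exact fderiv_fun_sub (differentiableAt_fderiv hf) (differentiableAt_fderiv hg)

/-- The velocity of the curve `t ↦ x + t w + t² z`. -/
theorem hasDerivAt_curve (w z : E n) (t : ℝ) :
    HasDerivAt (fun t : ℝ => x + t • w + t ^ 2 • z) (w + (2 * t) • z) t := by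
  have h1 : HasDerivAt (fun t : ℝ => t • w) ((1 : ℝ) • w) t := (hasDerivAt_id t).smul_const w
  have h2 : HasDerivAt (fun t : ℝ => t ^ 2 • z) ((2 * t) • z) t := by
    simpa using (hasDerivAt_pow 2 t).smul_const z
  rw [one_smul] at h1
  exact (h1.const_add x).add h2

theorem tendsto_curve (w z : E n) :
    Tendsto (fun t : ℝ => x + t • w + t ^ 2 • z) (𝓝 0) (𝓝 x) := by
  have h : ContinuousAt (fun t : ℝ => x + t • w + t ^ 2 • z) 0 := by fun_prop
  simpa [ContinuousAt] using h

theorem eventually_deriv_curve (hf : ContDiffAt ℝ 2 f x) (w z : E n) :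
    (deriv fun t : ℝ => f (x + t • w + t ^ 2 • z)) =ᶠ[𝓝 0]
      fun t => fderiv ℝ f (x + t • w + t ^ 2 • z) (w + (2 * t) • z) := by
  filter_upwards [(tendsto_curve w z).eventually (eventually_differentiableAt hf)] with t ht
  exact (ht.hasFDerivAt.comp_hasDerivAt t (hasDerivAt_curve w z t)).deriv

theorem deriv_curve (hf : ContDiffAt ℝ 2 f x) (w z : E n) :
    deriv (fun t : ℝ => f (x + t • w + t ^ 2 • z)) 0 = fderiv ℝ f x w := by
  simpa using (eventually_deriv_curve hf w z).self_of_nhds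

/-- The second derivative of `f` along the curve `t ↦ x + t w + t² z`. -/
theorem deriv_deriv_curve (hf : ContDiffAt ℝ 2 f x) (w z : E n) :
    deriv (deriv fun t : ℝ => f (x + t • w + t ^ 2 • z)) 0 =
      D2 f x w w + 2 * fderiv ℝ f x z := by
  rw [(eventually_deriv_curve hf w z).deriv_eq]
  have h1 : HasDerivAt (fun t : ℝ => fderiv ℝ f (x + t • w + t ^ 2 • z)) (D2 f x w) 0 := by
    have hd : HasFDerivAt (fderiv ℝ f) (D2 f x) (x + (0 : ℝ) • w + (0 : ℝ) ^ 2 • z) := by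
      simpa using (differentiableAt_fderiv hf).hasFDerivAt
    have h := hd.comp_hasDerivAt 0 (hasDerivAt_curve w z 0)
    rw [mul_zero, zero_smul, add_zero] at h
    exact h
  have h2 : HasDerivAt (fun t : ℝ => w + (2 * t) • z) ((2 : ℝ) • z) 0 := by
    simpa using (((hasDerivAt_id (0 : ℝ)).const_mul 2).smul_const z).const_add w
  simpa using (h1.clm_apply h2).deriv

theorem contDiffAt_curve (hf : ContDiffAt ℝ 2 f x) (w z : E n) :
    ContDiffAt ℝ 2 (fun t : ℝ => f (x + t • w + t ^ 2 • z)) 0 := by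
  have h1 : ContDiffAt ℝ 2 (fun t : ℝ => x + t • w + t ^ 2 • z) 0 := by fun_prop
  have h2 : ContDiffAt ℝ 2 f (x + (0 : ℝ) • w + (0 : ℝ) ^ 2 • z) := by simpa using hf
  exact h2.comp (0 : ℝ) h1

/-- The second derivative is nonpositive at a local maximum. -/
theorem deriv_deriv_nonpos_of_isLocalMax {h : ℝ → ℝ} {a : ℝ} (hm : IsLocalMax h a)
    (hc : ContinuousAt h a) : deriv (deriv h) a ≤ 0 := by
  by_contra! hpos
  -- A positive second derivative would make `a` a local minimum as well, so `h` would be constant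
  -- near `a`.
  have hmin := isLocalMin_of_deriv_deriv_pos hpos hm.deriv_eq_zero hc
  have heq : h =ᶠ[𝓝 a] fun _ => h a := by
    filter_upwards [hm, hmin] with y h1 h2
    exact le_antisymm h1 h2
  have h0 : deriv (deriv h) a = 0 := by
    rw [heq.deriv.deriv_eq]
    simp
  exact hpos.ne' h0

theorem D2_nonpos_of_isLocalMax (hf : ContDiffAt ℝ 2 f x) (hm : IsLocalMax f x) (w : E n) :
    D2 f x w w ≤ 0 := by
  have hmax : IsLocalMax (fun t : ℝ => f (x + t • w + t ^ 2 • (0 : E n))) 0 := by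
    have := (tendsto_curve (x := x) w 0).eventually hm
    simpa [IsLocalMax, IsMaxFilter] using this
  have h := deriv_deriv_nonpos_of_isLocalMax hmax (contDiffAt_curve hf w 0).continuousAt
  rw [deriv_deriv_curve hf] at h
  simpa using h

/-- Chain rule for a function of one variable after `f`. -/
theorem fderiv_comp_real {v v' : ℝ → ℝ} (hv : ∀ᶠ s in 𝓝 (f x), HasDerivAt v (v' s) s)
    (hf : ContDiffAt ℝ 2 f x) :
    fderiv ℝ (fun y => v (f y)) =ᶠ[𝓝 x] fun y => v' (f y) • fderiv ℝ f y := by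
  filter_upwards [eventually_differentiableAt hf, hf.continuousAt.eventually hv] with y h1 h2
  exact (h2.comp_hasFDerivAt y h1.hasFDerivAt).fderiv

theorem D2_comp_real {v v' : ℝ → ℝ} {v'' : ℝ} (hv : ∀ᶠ s in 𝓝 (f x), HasDerivAt v (v' s) s)
    (hv' : HasDerivAt v' v'' (f x)) (hf : ContDiffAt ℝ 2 f x) (w z : E n) :
    D2 (fun y => v (f y)) x w z =
      v' (f x) * D2 f x w z + v'' * (fderiv ℝ f x w * fderiv ℝ f x z) := by
  rw [D2, (fderiv_comp_real hv hf).fderiv_eq]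
  have h1 : HasFDerivAt (fun y => v' (f y)) (v'' • fderiv ℝ f x) x :=
    hv'.comp_hasFDerivAt x (hf.differentiableAt (by norm_num)).hasFDerivAt
  have h2 := h1.smul (differentiableAt_fderiv hf).hasFDerivAt
  erw [h2.fderiv]
  simp
  ring

end Calculus

/-! ### Traces in orthonormal bases -/

section Trace

variable {n : ℕ}

theorem sum_mul_basis (e : OrthonormalBasis (Fin n) ℝ (E n)) (a b : Fin n) :
    ∑ i, e i a * e i b = if a = b then 1 else 0 := by
  have h := e.sum_inner_mul_inner (EuclideanSpace.single a (1 : ℝ)) (EuclideanSpace.single b 1)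
  simp only [EuclideanSpace.inner_single_left, EuclideanSpace.inner_single_right] at h
  simpa [eq_comm, Pi.single_apply] using h

theorem bilin_eq_sum (B : E n →L[ℝ] E n →L[ℝ] ℝ) (v w : E n) :
    B v w = ∑ a, ∑ b, v a * w b *
      B (EuclideanSpace.single a 1) (EuclideanSpace.single b 1) := by
  have hv : ∀ v : E n, v = ∑ a, v a • EuclideanSpace.single a (1 : ℝ) := fun v => by
    simpa using ((EuclideanSpace.basisFun (Fin n) ℝ).sum_repr v).symm
  conv_lhs => rw [hv v, hv w]
  simp only [map_sum, map_smul, sum_apply, smul_apply,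
    smul_eq_mul, Finset.mul_sum]
  rw [Finset.sum_comm]
  exact Finset.sum_congr rfl fun a _ => Finset.sum_congr rfl fun b _ => by ring

theorem sum_smul_basis_bilin (e : OrthonormalBasis (Fin n) ℝ (E n)) (c : Fin n → ℝ)
    (B : E n →L[ℝ] E n →L[ℝ] ℝ) :
    ∑ i, c i * B (e i) (e i) = ∑ a, ∑ b, (∑ i, c i * (e i a * e i b)) *
      B (EuclideanSpace.single a 1) (EuclideanSpace.single b 1) := by
  simp_rw [fun i => bilin_eq_sum B (e i) (e i), Finset.mul_sum, Finset.sum_mul]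
  rw [Finset.sum_comm]
  refine Finset.sum_congr rfl fun a _ => ?_
  rw [Finset.sum_comm]
  refine Finset.sum_congr rfl fun b _ => Finset.sum_congr rfl fun i _ => by ring

/-- The trace of a bilinear form does not depend on the orthonormal basis. -/
theorem sum_basis_bilin (e : OrthonormalBasis (Fin n) ℝ (E n)) (B : E n →L[ℝ] E n →L[ℝ] ℝ) :
    ∑ i, B (e i) (e i) =
      ∑ a, B (EuclideanSpace.single a 1) (EuclideanSpace.single a 1) := by
  have h := sum_smul_basis_bilin e (fun _ => 1) B
  simp only [one_mul, sum_mul_basis] at h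
  simpa using h

end Trace

/-! ### Singular vectors of the differential -/

section SingularVectors

variable {n m : ℕ}

theorem pderiv_component {u : E n → E m} {x : E n} (hu : DifferentiableAt ℝ u x) (i : Fin n)
    (α : Fin m) : pderiv i (fun y => u y α) x = fderiv ℝ u x (EuclideanSpace.single i 1) α := by
  have h := (EuclideanSpace.proj (𝕜 := ℝ) α).hasFDerivAt.comp x hu.hasFDerivAt
  exact congrArg (fun L : E n →L[ℝ] ℝ => L (EuclideanSpace.single i 1)) h.fderiv

/-- The induced metric as a bilinear form. -/
theorem sum_metric_mul {u : E n → E m} {x : E n} (hu : DifferentiableAt ℝ u x) (i : Fin n)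
    (v : E n) : ∑ j, metric u x i j * v j =
      v i + inner ℝ (fderiv ℝ u x (EuclideanSpace.single i 1)) (fderiv ℝ u x v) := by
  have hv : fderiv ℝ u x v = ∑ j, v j • fderiv ℝ u x (EuclideanSpace.single j 1) := by
    conv_lhs => rw [← (EuclideanSpace.basisFun (Fin n) ℝ).sum_repr v]
    simp
  rw [hv, inner_sum]
  simp only [metric, Matrix.of_apply, add_mul, Finset.sum_add_distrib, pderiv_component hu,
    inner_smul_right, PiLp.inner_apply, RCLike.inner_apply, conj_trivial]
  congr 1
  · simp
  · refine Finset.sum_congr rfl fun j _ => ?_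
    rw [mul_comm (v j)]
    congr 1
    exact Finset.sum_congr rfl fun α _ => mul_comm _ _

/-- Diagonalization of the induced metric by the singular vectors of the differential. -/
theorem exists_singular_basis {u : E n → E m} {x : E n} (hu : DifferentiableAt ℝ u x) :
    ∃ e : OrthonormalBasis (Fin n) ℝ (E n),
      (∀ i, ‖fderiv ℝ u x (e i)‖ ^ 2 = (fderiv ℝ u x).toLinearMap.singularValues i ^ 2) ∧
      (∀ B : E n →L[ℝ] E n →L[ℝ] ℝ, ∑ a, ∑ b, (metric u x)⁻¹ a b *
        B (EuclideanSpace.single a 1) (EuclideanSpace.single b 1) =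
          ∑ i : Fin n, (1 + (fderiv ℝ u x).toLinearMap.singularValues i ^ 2)⁻¹ * B (e i) (e i)) ∧
      (metric u x).det = ∏ i : Fin n, (1 + (fderiv ℝ u x).toLinearMap.singularValues i ^ 2) := by
  set A := (fderiv ℝ u x).toLinearMap with hA
  have hfin : Module.finrank ℝ (E n) = n := finrank_euclideanSpace_fin
  set e := A.isSymmetric_adjoint_comp_self.eigenvectorBasis hfin with he
  have hinner : ∀ i v, inner ℝ (A v) (A (e i)) = A.singularValues i ^ 2 * inner ℝ v (e i) := by
    intro i v
    rw [← LinearMap.adjoint_inner_right, ← LinearMap.comp_apply, he,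
      LinearMap.IsSymmetric.apply_eigenvectorBasis, ← A.sq_singularValues_fin hfin]
    simp [inner_smul_right]
  have hdiag : ∀ a i, ∑ b, metric u x a b * e i b = (1 + A.singularValues i ^ 2) * e i a := by
    intro a i
    rw [sum_metric_mul hu]
    have := hinner i (EuclideanSpace.single a 1)
    simp only [hA, ContinuousLinearMap.coe_coe, EuclideanSpace.inner_single_left] at this
    rw [this]
    simp
    ring
  have hpos : ∀ i : Fin n, 0 < 1 + A.singularValues i ^ 2 := fun i => by positivity
  let U : Matrix (Fin n) (Fin n) ℝ := Matrix.of fun a i => e i a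
  have hUU : U * Uᵀ = 1 := by
    ext a b
    simp [U, Matrix.mul_apply, Matrix.one_apply, sum_mul_basis]
  have hgU : metric u x * U = U * Matrix.diagonal fun i : Fin n => 1 + A.singularValues i ^ 2 := by
    ext a i
    rw [Matrix.mul_diagonal]
    simp [U, Matrix.mul_apply, hdiag, mul_comm]
  have hinv : (metric u x)⁻¹ =
      U * (Matrix.diagonal fun i : Fin n => (1 + A.singularValues i ^ 2)⁻¹) * Uᵀ := by
    apply Matrix.inv_eq_right_inv
    rw [← mul_assoc, ← mul_assoc, hgU, mul_assoc U, Matrix.diagonal_mul_diagonal]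
    have : (fun i : Fin n => (1 + A.singularValues i ^ 2) * (1 + A.singularValues i ^ 2)⁻¹) = 1 :=
      funext fun i => mul_inv_cancel₀ (hpos i).ne'
    rw [this]
    simpa using hUU
  refine ⟨e, fun i => ?_, fun B => ?_, ?_⟩
  · have := hinner i (e i)
    rw [real_inner_self_eq_norm_sq, real_inner_self_eq_norm_sq, e.norm_eq_one] at this
    simpa [hA] using this
  · rw [sum_smul_basis_bilin e]
    refine Finset.sum_congr rfl fun a _ => Finset.sum_congr rfl fun b _ => ?_
    congr 1
    rw [hinv, Matrix.mul_apply]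
    simp_rw [Matrix.mul_diagonal]
    refine Finset.sum_congr rfl fun i _ => ?_
    simp [U]
    ring
  · have h := congrArg Matrix.det hgU
    have hU : U.det * U.det = 1 := by
      simpa using congrArg Matrix.det hUU
    rw [Matrix.det_mul, Matrix.det_mul, Matrix.det_diagonal] at h
    calc (metric u x).det = (metric u x).det * U.det * U.det := by rw [mul_assoc, hU, mul_one]
      _ = _ := by rw [h, mul_right_comm, hU, one_mul]

end SingularVectors

/-! ### The trace inequality for area decreasing differentials -/

section TraceInequality

variable {n : ℕ} (e : OrthonormalBasis (Fin n) ℝ (E n)) {s : Fin n → ℝ}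

theorem sum_sq_inner_basis {N : E n} (hN : ‖N‖ = 1) : ∑ i, inner ℝ (e i) N ^ 2 = 1 := by
  have h := e.sum_sq_norm_inner_right N
  simpa [hN] using h

/-- The squared length of a unit covector in the inverse metric is at least `1 / (1 + s₀²)`. -/
theorem inv_le_sum_inv_mul_sq {N : E n} (hN : ‖N‖ = 1) {M : ℝ} (hM : ∀ i, 1 + s i ^ 2 ≤ M) :
    M⁻¹ ≤ ∑ i, (1 + s i ^ 2)⁻¹ * inner ℝ (e i) N ^ 2 := by
  calc M⁻¹ = ∑ i, M⁻¹ * inner ℝ (e i) N ^ 2 := by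
        rw [← Finset.mul_sum, sum_sq_inner_basis e hN, mul_one]
    _ ≤ _ := Finset.sum_le_sum fun i _ => mul_le_mul_of_nonneg_right
        (inv_anti₀ (by positivity) (hM i)) (sq_nonneg _)

/-- Subtracting the nonpositive trace leaves -Σ (1 - Gᵢ) B(eᵢ,eᵢ) with Gᵢ = 1/(1 + sᵢ²). Let k carry
the largest singular value. For i ≠ k, sᵢ s_k ≤ 1 gives 1 - Gᵢ ≤ G_k ≤ q, so each such term costs at
most cq. For i = k the weight may be close to 1, but B annihilates N, so B(e_k,e_k) ≥ -c(1 -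
⟨e_k,N⟩²); the bracket is the mass of N on the other eᵢ, where Gᵢ ≥ 1/2, hence at most 2q. The total
is (n - 1) + 2 = n + 1. -/
theorem sum_inv_mul_bilin_le (hs : ∀ i, 0 ≤ s i) (hss : ∀ i j, i ≠ j → s i * s j ≤ 1)
    {B : E n →L[ℝ] E n →L[ℝ] ℝ} (hsymm : ∀ v w, B v w = B w v) {N : E n} (hN : ‖N‖ = 1)
    (hBN : B N = 0) (htr : ∑ i, B (e i) (e i) ≤ 0) {c : ℝ} (hc : 0 ≤ c)
    (hB : ∀ w, -c * ‖w‖ ^ 2 ≤ B w w) :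
    ∑ i, (1 + s i ^ 2)⁻¹ * B (e i) (e i) ≤
      c * ((n + 1) * ∑ i, (1 + s i ^ 2)⁻¹ * inner ℝ (e i) N ^ 2) := by
  set q := ∑ i, (1 + s i ^ 2)⁻¹ * inner ℝ (e i) N ^ 2 with hq
  rcases isEmpty_or_nonempty (Fin n) with hemp | hne
  · simp [hq]
  obtain ⟨k, hk⟩ := Finite.exists_max s
  have hpos : ∀ i, 0 < 1 + s i ^ 2 := fun i => by positivity
  have hqk : (1 + s k ^ 2)⁻¹ ≤ q := inv_le_sum_inv_mul_sq e hN fun i => by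
    have := pow_le_pow_left₀ (hs i) (hk i) 2
    linarith
  have hne' : ∀ i, i ≠ k → s i ^ 2 ≤ 1 ∧ s i ^ 2 * s k ^ 2 ≤ 1 := fun i hi => by
    have h1 := hss i k hi
    have h2 := mul_le_mul_of_nonneg_left (hk i) (hs i)
    have h3 := mul_nonneg (hs i) (hs k)
    constructor <;> nlinarith
  have hb : 1 - inner ℝ (e k) N ^ 2 ≤ 2 * q := by
    have h1 := sum_sq_inner_basis e hN
    rw [← Finset.add_sum_erase _ _ (Finset.mem_univ k)] at h1 hq
    have h2 : ∑ i ∈ Finset.univ.erase k, inner ℝ (e i) N ^ 2 ≤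
        2 * ∑ i ∈ Finset.univ.erase k, (1 + s i ^ 2)⁻¹ * inner ℝ (e i) N ^ 2 := by
      rw [Finset.mul_sum]
      refine Finset.sum_le_sum fun i hi => ?_
      have h3 : (2 : ℝ)⁻¹ ≤ (1 + s i ^ 2)⁻¹ :=
        inv_anti₀ (hpos i) (by linarith [(hne' i (Finset.ne_of_mem_erase hi)).1])
      nlinarith [sq_nonneg (inner ℝ (e i) N)]
    have h4 : 0 ≤ (1 + s k ^ 2)⁻¹ * inner ℝ (e k) N ^ 2 := by
      have := hpos k
      positivity
    linarith
  have hkk : -c * (1 - inner ℝ (e k) N ^ 2) ≤ B (e k) (e k) := by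
    have h1 := hB (e k - (inner ℝ (e k) N : ℝ) • N)
    have h2 : ‖e k - (inner ℝ (e k) N : ℝ) • N‖ ^ 2 = 1 - inner ℝ (e k) N ^ 2 := by
      rw [norm_sub_sq_real, inner_smul_right, norm_smul, e.norm_eq_one, hN]
      simp
      ring
    have h3 : ∀ w, B w N = 0 := fun w => by rw [hsymm, hBN]; rfl
    rw [h2] at h1
    simpa [h3, hBN] using h1
  have hle : ∀ i, (1 + s i ^ 2)⁻¹ * B (e i) (e i) ≤ B (e i) (e i) +
      c * (if i = k then 2 * q else q) := by
    intro i
    have hG1 : (1 + s i ^ 2)⁻¹ ≤ 1 := inv_le_one_of_one_le₀ (by nlinarith [sq_nonneg (s i)])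
    have hG0 : 0 < (1 + s i ^ 2)⁻¹ := inv_pos.2 (hpos i)
    split_ifs with h
    · subst h
      have : c * (1 - inner ℝ (e i) N ^ 2) ≤ c * (2 * q) := mul_le_mul_of_nonneg_left hb hc
      have h0 : 0 ≤ c * (1 - inner ℝ (e i) N ^ 2) := by
        apply mul_nonneg hc
        have h1 := sum_sq_inner_basis e hN
        have h2 := Finset.single_le_sum (f := fun i => inner ℝ (e i) N ^ 2)
          (fun j _ => sq_nonneg _) (Finset.mem_univ i)
        linarith
      nlinarith
    · have h1 : 1 - (1 + s i ^ 2)⁻¹ ≤ q := by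
        refine le_trans ?_ hqk
        rw [sub_le_iff_le_add, ← one_div, ← one_div, div_add_div _ _ (hpos k).ne' (hpos i).ne',
          le_div_iff₀ (mul_pos (hpos k) (hpos i))]
        nlinarith [(hne' i h).2]
      have h2 := hB (e i)
      rw [e.norm_eq_one] at h2
      nlinarith [mul_le_mul_of_nonneg_left h1 hc]
  calc _ ≤ ∑ i, (B (e i) (e i) + c * (if i = k then 2 * q else q)) :=
        Finset.sum_le_sum fun i _ => hle i
    _ = ∑ i, B (e i) (e i) + c * ∑ i, (if i = k then 2 * q else q) := by
        rw [Finset.sum_add_distrib, ← Finset.mul_sum]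
    _ ≤ c * ∑ i, (q + if i = k then q else 0) := by
        have : ∀ i, (if i = k then 2 * q else q) = q + if i = k then q else 0 := fun i => by
          split_ifs <;> ring
        simp_rw [this]
        linarith
    _ = c * ((n + 1) * q) := by
        rw [Finset.sum_add_distrib]
        simp
        ring_nf
        simp

end TraceInequality

/-! ### The distance to the boundary and the mean curvature of the boundary -/

section NormOfDifferential

variable {n : ℕ} {f : E n → ℝ} {x N : E n}

/-- Through the Riesz isometry the norm is the square root of a squared Hilbert norm, whose
derivative at cN is the pairing with N. -/
theorem hasFDerivAt_norm_fderiv (hf : ContDiffAt ℝ 2 f x) {c : ℝ} (hc : 0 < c) (hN : ‖N‖ = 1)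
    (hfN : fderiv ℝ f x = c • innerSL ℝ N) :
    HasFDerivAt (fun y => ‖fderiv ℝ f y‖) ((D2 f x).flip N) x := by
  let J := (InnerProductSpace.toDual ℝ (E n)).symm
  let J' : (E n →L[ℝ] ℝ) →L[ℝ] E n :=
    ⟨{ toFun := J, map_add' := J.map_add, map_smul' := fun c L => by simp }, J.continuous⟩
  have hJx : J (fderiv ℝ f x) = c • N := by
    apply (InnerProductSpace.toDual ℝ (E n)).injective
    rw [hfN, LinearIsometryEquiv.apply_symm_apply]
    ext v
    simp
  have h1 : HasFDerivAt (fun y => J (fderiv ℝ f y))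
      (J'.comp (D2 f x)) x :=
    J'.hasFDerivAt.comp x
      (differentiableAt_fderiv hf).hasFDerivAt
  have hn : ‖J (fderiv ℝ f x)‖ = c := by rw [hJx, norm_smul, hN]; simp [abs_of_pos hc]
  have h2 := h1.norm_sq.sqrt (by rw [hn]; positivity)
  rw [hn, hJx] at h2
  have hfun : (fun y => ‖fderiv ℝ f y‖) = fun y => √(‖J (fderiv ℝ f y)‖ ^ 2) := by
    funext y
    rw [Real.sqrt_sq (norm_nonneg _), LinearIsometryEquiv.norm_map]
  rw [hfun]
  refine h2.congr_fderiv ?_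
  ext v
  have h3 : inner ℝ N (J' (D2 f x v)) = D2 f x v N := by
    change inner ℝ N (J (D2 f x v)) = _
    rw [real_inner_comm, InnerProductSpace.toDual_symm_apply]
  rw [Real.sqrt_sq hc.le]
  simp
  rw [h3]
  field_simp

/-- The mean curvature of a level set in terms of the Hessian of the defining function. -/
theorem levelMeanCurvature_eq (hf : ContDiffAt ℝ 2 f x) {c : ℝ} (hc : 0 < c) (hN : ‖N‖ = 1)
    (hfN : fderiv ℝ f x = c • innerSL ℝ N) :
    levelMeanCurvature f x = -(c⁻¹ * (∑ a : Fin n, D2 f x (EuclideanSpace.single a 1)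
      (EuclideanSpace.single a 1) - D2 f x N N)) := by
  have hnorm : ‖fderiv ℝ f x‖ = c := by
    rw [hfN, norm_smul, innerSL_apply_norm, hN]
    simp [abs_of_pos hc]
  have hterm : ∀ a : Fin n, pderiv a (fun y => pderiv a f y / ‖fderiv ℝ f y‖) x =
      c⁻¹ * (D2 f x (EuclideanSpace.single a 1) (EuclideanSpace.single a 1) -
        N a * D2 f x (EuclideanSpace.single a 1) N) := by
    intro a
    have h1 : HasFDerivAt (fun y => pderiv a f y)
        ((D2 f x).flip (EuclideanSpace.single a 1)) x := by
      have h := (differentiableAt_fderiv hf).hasFDerivAt.clm_apply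
        (hasFDerivAt_const (EuclideanSpace.single a (1 : ℝ)) x)
      refine h.congr_fderiv ?_
      ext v
      simp
    have h2 := h1.mul ((hasDerivAt_inv (by rw [hnorm]; exact hc.ne')).comp_hasFDerivAt x
      (hasFDerivAt_norm_fderiv hf hc hN hfN))
    have h3 := congrArg (fun L : E n →L[ℝ] ℝ => L (EuclideanSpace.single a 1)) h2.fderiv
    simp only [div_eq_mul_inv]
    refine Eq.trans h3 ?_
    simp only [Function.comp_apply, hnorm]
    have h4 : pderiv a f x = c * N a := by
      rw [pderiv, hfN]
      simp [EuclideanSpace.inner_single_right]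
    rw [h4]
    simp
    field_simp
    ring
  have hNN : D2 f x N N = ∑ a, N a * D2 f x (EuclideanSpace.single a 1) N := by
    have : N = ∑ a, N a • EuclideanSpace.single a (1 : ℝ) := by
      simpa using ((EuclideanSpace.basisFun (Fin n) ℝ).sum_repr N).symm
    have h := congrArg (fun v => D2 f x v N) this
    simpa using h
  rw [levelMeanCurvature, Finset.sum_congr rfl fun a _ => hterm a, ← Finset.mul_sum,
    Finset.sum_sub_distrib, hNN]

/-- A nonnegative trace on the complement of `N`. -/
theorem trace_sub_nonneg (Q : E n →L[ℝ] E n →L[ℝ] ℝ) (hsymm : ∀ v w, Q v w = Q w v)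
    (hN : ‖N‖ = 1) (hQ : ∀ w, inner ℝ N w = 0 → 0 ≤ Q w w) :
    0 ≤ ∑ a : Fin n, Q (EuclideanSpace.single a 1) (EuclideanSpace.single a 1) - Q N N := by
  have hw : ∀ a : Fin n, 0 ≤ Q (EuclideanSpace.single a 1) (EuclideanSpace.single a 1) -
      2 * (N a * Q (EuclideanSpace.single a 1) N) + N a * N a * Q N N := by
    intro a
    have h := hQ (EuclideanSpace.single a 1 - N a • N) (by
      rw [inner_sub_right, inner_smul_right, real_inner_self_eq_norm_sq, hN]
      simp [EuclideanSpace.inner_single_right])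
    simp only [map_sub, map_smul, sub_apply, smul_apply, smul_eq_mul] at h
    rw [hsymm N (EuclideanSpace.single a 1)] at h
    linarith
  have hNN : Q N N = ∑ a, N a * Q (EuclideanSpace.single a 1) N := by
    have : N = ∑ a, N a • EuclideanSpace.single a (1 : ℝ) := by
      simpa using ((EuclideanSpace.basisFun (Fin n) ℝ).sum_repr N).symm
    have h := congrArg (fun v => Q v N) this
    simpa using h
  have hN1 : ∑ a, N a * N a = 1 := by
    have := real_inner_self_eq_norm_sq N
    rw [hN, PiLp.inner_apply] at this
    simpa [sq] using this
  have hsum := Finset.sum_nonneg fun a (_ : a ∈ Finset.univ) => hw a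
  rw [Finset.sum_add_distrib, Finset.sum_sub_distrib, ← Finset.mul_sum, ← hNN, ← Finset.sum_mul,
    hN1] at hsum
  linarith

end NormOfDifferential

/-! ### Gradient, Hessian and superharmonicity of the boundary distance. -/

section BoundaryDistance

variable {n : ℕ} {Ω : Set (E n)} {x p : E n}

theorem bdist_lipschitz : LipschitzWith 1 (bdist Ω) := Metric.lipschitz_infDist_pt _

theorem bdist_nonneg : 0 ≤ bdist Ω x := Metric.infDist_nonneg

theorem bdist_le_dist (hp : p ∈ frontier Ω) (x : E n) : bdist Ω x ≤ dist x p :=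
  Metric.infDist_le_dist_of_mem hp

theorem notMem_of_mem_frontier (hopen : IsOpen Ω) (hp : p ∈ frontier Ω) : p ∉ Ω := fun h =>
  (hopen.frontier_eq ▸ hp).2 h

theorem bdist_pos (hopen : IsOpen Ω) (hne : (frontier Ω).Nonempty) (hx : x ∈ Ω) :
    0 < bdist Ω x :=
  (isClosed_frontier.notMem_iff_infDist_pos hne).1 fun h => notMem_of_mem_frontier hopen h hx

/-- The ball is connected and misses the frontier, so it cannot meet both Ω and the complement of
its closure. -/
theorem ball_bdist_subset (hopen : IsOpen Ω) (hne : (frontier Ω).Nonempty) (hx : x ∈ Ω) :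
    Metric.ball x (bdist Ω x) ⊆ Ω := by
  have hconn : IsPreconnected (Metric.ball x (bdist Ω x)) := (convex_ball _ _).isPreconnected
  refine hconn.subset_left_of_subset_union hopen (v := (closure Ω)ᶜ)
    isClosed_closure.isOpen_compl ?_ ?_ ⟨x, Metric.mem_ball_self (bdist_pos hopen hne hx), hx⟩
  · exact disjoint_compl_right.mono_left subset_closure
  · intro y hy
    by_contra h
    simp only [mem_union, mem_compl_iff, not_or, not_not] at h
    have hf : y ∈ frontier Ω := by rw [hopen.frontier_eq]; exact ⟨h.2, h.1⟩
    have := bdist_le_dist hf x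
    rw [Metric.mem_ball, dist_comm] at hy
    linarith

theorem bdist_le_dist_of_notMem (hopen : IsOpen Ω) (hne : (frontier Ω).Nonempty) (hx : x ∈ Ω)
    {q : E n} (hq : q ∉ Ω) : bdist Ω x ≤ dist x q := by
  by_contra! h
  exact hq (ball_bdist_subset hopen hne hx (by rwa [Metric.mem_ball, dist_comm]))

/-- Where it is differentiable, the distance to the boundary has as gradient the unit vector that
points away from a nearest boundary point. -/
theorem fderiv_bdist (hp : p ∈ frontier Ω) {N : E n} (hN : ‖N‖ = 1) {r : ℝ} (hr : 0 < r)
    (hx : x = p + r • N) (hdist : bdist Ω x = r) (hd : DifferentiableAt ℝ (bdist Ω) x) :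
    fderiv ℝ (bdist Ω) x = innerSL ℝ N := by
  set L := fderiv ℝ (bdist Ω) x with hL
  have hLN : L N = 1 := by
    have hcurve : HasDerivAt (fun t : ℝ => x - t • N) (-N) 0 := by
      simpa using ((hasDerivAt_id (0 : ℝ)).smul_const N).const_sub x
    have hd0 : HasFDerivAt (bdist Ω) L (x - (0 : ℝ) • N) := by simpa using hd.hasFDerivAt
    have h1 := (hd0.comp_hasDerivAt 0 hcurve).add (hasDerivAt_id (0 : ℝ))
    -- Moving towards p by t leaves p at distance r - t, so d(x - tN) + t ≤ r with equality at t =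
    -- 0. This gives L N = 1, and ‖L‖ ≤ 1 then forces the gradient to be N.
    have hmax : IsLocalMax (bdist Ω ∘ (fun t : ℝ => x - t • N) + id) 0 := by
      filter_upwards [Iio_mem_nhds hr] with t ht
      have ht' : t < r := ht
      have : dist (x - t • N) p = r - t := by
        rw [hx, dist_eq_norm, show p + r • N - t • N - p = (r - t) • N by rw [sub_smul]; abel,
          norm_smul, hN, mul_one, Real.norm_of_nonneg (by linarith)]
      have h2 := bdist_le_dist hp (x - t • N)
      simp only [Pi.add_apply, Function.comp_apply, id, zero_smul, sub_zero, hdist]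
      linarith
    have h3 := hmax.hasDerivAt_eq_zero h1
    rw [map_neg] at h3
    linarith
  have hLn : ‖L‖ ≤ 1 := by simpa using norm_fderiv_le_of_lipschitz ℝ (bdist_lipschitz (Ω := Ω))
  set g := (InnerProductSpace.toDual ℝ (E n)).symm L with hg
  have hgN : inner ℝ g N = 1 := by rw [hg, InnerProductSpace.toDual_symm_apply, hLN]
  have hgn : ‖g‖ ≤ 1 := by rwa [hg, LinearIsometryEquiv.norm_map]
  have h0 : ‖g - N‖ ^ 2 ≤ 0 := by
    rw [norm_sub_sq_real, hgN, hN]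
    nlinarith [norm_nonneg g]
  have h1 : g = N := by
    rw [← sub_eq_zero, ← norm_eq_zero]
    nlinarith [norm_nonneg (g - N)]
  ext v
  rw [← h1, innerSL_apply_apply, hg, InnerProductSpace.toDual_symm_apply]

theorem exists_nearest (hopen : IsOpen Ω) (hne : (frontier Ω).Nonempty) (hx : x ∈ Ω) :
    ∃ p ∈ frontier Ω, ∃ N : E n, ‖N‖ = 1 ∧ x = p + bdist Ω x • N := by
  obtain ⟨p, hp, hxp⟩ := isClosed_frontier.exists_infDist_eq_dist hne x
  have hr := bdist_pos hopen hne hx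
  have hxp' : bdist Ω x = ‖x - p‖ := by rw [← dist_eq_norm]; exact hxp
  refine ⟨p, hp, (bdist Ω x)⁻¹ • (x - p), ?_, ?_⟩
  · rw [norm_smul, ← hxp', norm_inv, Real.norm_of_nonneg hr.le, inv_mul_cancel₀ hr.ne']
  · rw [smul_inv_smul₀ hr.ne']
    abel

/-- Differentiate the eikonal equation |Dd| = 1, which holds near x. -/
theorem D2_bdist_apply_normal (hopen : IsOpen Ω) (hne : (frontier Ω).Nonempty) (hx : x ∈ Ω)
    (hd : ContDiffAt ℝ 2 (bdist Ω) x) {N : E n} (hN : ‖N‖ = 1)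
    (hfN : fderiv ℝ (bdist Ω) x = innerSL ℝ N) : D2 (bdist Ω) x N = 0 := by
  have h1 := hasFDerivAt_norm_fderiv hd one_pos hN (by rw [hfN, one_smul])
  have h2 : (fun y => ‖fderiv ℝ (bdist Ω) y‖) =ᶠ[𝓝 x] fun _ => 1 := by
    filter_upwards [eventually_differentiableAt hd, hopen.mem_nhds hx] with y hy hyΩ
    obtain ⟨q, hq, M, hM, hyM⟩ := exists_nearest hopen hne hyΩ
    rw [fderiv_bdist hq hM (bdist_pos hopen hne hyΩ) hyM rfl hy, innerSL_apply_norm, hM]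
  have h3 := h1.unique ((hasFDerivAt_const (1 : ℝ) x).congr_of_eventuallyEq h2)
  ext v
  rw [D2_symm hd, ← ContinuousLinearMap.flip_apply, h3]

/-- The gradient of a defining function at a nearest boundary point. -/
theorem fderiv_definingFunction (hopen : IsOpen Ω) (hne : (frontier Ω).Nonempty) (hx : x ∈ Ω)
    (hp : p ∈ frontier Ω) {N : E n} (hN : ‖N‖ = 1) (hxN : x = p + bdist Ω x • N)
    {U : Set (E n)} {ρ : E n → ℝ} (hρ : IsLocalDefiningFunction Ω U ρ p) :
    ρ p = 0 ∧ ∃ c : ℝ, 0 < c ∧ fderiv ℝ ρ p = c • innerSL ℝ N := by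
  have hU : U ∈ 𝓝 p := hρ.isOpen.mem_nhds hρ.mem
  have hC : ContDiffAt ℝ 2 ρ p := hρ.contDiffOn.contDiffAt hU
  have hr := bdist_pos hopen hne hx
  -- The ball about x of radius d(x) lies in Ω and touches the boundary at p, so every direction
  -- with positive N-component enters Ω.
  have hin : ∀ h : E n, 0 < inner ℝ N h → ∀ᶠ t : ℝ in 𝓝[>] 0, 0 < ρ (p + t • h) := by
    intro h hh
    have h1 : ∀ᶠ t : ℝ in 𝓝[>] 0, p + t • h ∈ U := by
      have : Tendsto (fun t : ℝ => p + t • h) (𝓝[>] 0) (𝓝 p) := by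
        have hc : ContinuousAt (fun t : ℝ => p + t • h) 0 := by fun_prop
        simpa [ContinuousAt] using hc.tendsto.mono_left nhdsWithin_le_nhds
      exact this hU
    have h2 : ∀ᶠ t : ℝ in 𝓝[>] 0, t * ‖h‖ ^ 2 < 2 * bdist Ω x * inner ℝ N h := by
      have : Tendsto (fun t : ℝ => t * ‖h‖ ^ 2) (𝓝[>] 0) (𝓝 0) := by
        have hc : ContinuousAt (fun t : ℝ => t * ‖h‖ ^ 2) 0 := by fun_prop
        simpa [ContinuousAt] using hc.tendsto.mono_left nhdsWithin_le_nhds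
      exact this.eventually_lt_const (by positivity)
    filter_upwards [h1, h2, self_mem_nhdsWithin] with t ht1 ht2 ht0
    have ht0' : 0 < t := ht0
    refine (hρ.mem_iff _ ht1).1 (ball_bdist_subset hopen hne hx ?_)
    rw [Metric.mem_ball, dist_eq_norm]
    refine lt_of_pow_lt_pow_left₀ 2 hr.le ?_
    have : p + t • h - x = t • h - bdist Ω x • N := by
      conv_lhs => rw [hxN]
      abel
    rw [this, norm_sub_sq_real, norm_smul, norm_smul, hN, inner_smul_left, inner_smul_right,
      real_inner_comm]
    simp only [conj_trivial, Real.norm_eq_abs, mul_pow, sq_abs, mul_one]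
    nlinarith
  have hρ0 : ρ p = 0 := by
    refine le_antisymm ?_ ?_
    · by_contra! h
      exact notMem_of_mem_frontier hopen hp ((hρ.mem_iff p hρ.mem).2 h)
    · have hNN : 0 < inner ℝ N N := by rw [real_inner_self_eq_norm_sq, hN]; norm_num
      have hc : Tendsto (fun t : ℝ => ρ (p + t • N)) (𝓝[>] 0) (𝓝 (ρ p)) := by
        have h1 : Tendsto (fun t : ℝ => p + t • N) (𝓝[>] 0) (𝓝 p) := by
          have hc : ContinuousAt (fun t : ℝ => p + t • N) 0 := by fun_prop
          simpa [ContinuousAt] using hc.tendsto.mono_left nhdsWithin_le_nhds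
        exact hC.continuousAt.tendsto.comp h1
      exact ge_of_tendsto hc ((hin N hNN).mono fun t ht => ht.le)
  set L := fderiv ℝ ρ p with hL
  have hpos : ∀ h : E n, 0 < inner ℝ N h → 0 ≤ L h := by
    intro h hh
    have hcurve : HasDerivAt (fun t : ℝ => p + t • h) h 0 := by
      simpa using ((hasDerivAt_id (0 : ℝ)).smul_const h).const_add p
    have hd0 : HasFDerivAt ρ L (p + (0 : ℝ) • h) := by
      simpa using (hC.differentiableAt (by norm_num)).hasFDerivAt
    have h1 := (hd0.comp_hasDerivAt 0 hcurve).tendsto_slope_zero_right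
    refine ge_of_tendsto h1 ?_
    filter_upwards [hin h hh, self_mem_nhdsWithin] with t ht ht0
    have ht0' : 0 < t := ht0
    simp only [Function.comp_apply, zero_add, zero_smul, add_zero, hρ0, sub_zero, smul_eq_mul]
    positivity
  have hNN : inner ℝ N N = (1 : ℝ) := by rw [real_inner_self_eq_norm_sq, hN]; norm_num
  -- Tangential directions are limits of entering ones; applied to w and -w this makes the
  -- differential vanish on the complement of N.
  have hperp : ∀ w : E n, inner ℝ N w = 0 → 0 ≤ L w := by
    intro w hw
    have h1 : Tendsto (fun t : ℝ => L w + t * L N) (𝓝[>] 0) (𝓝 (L w)) := by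
      have hc : ContinuousAt (fun t : ℝ => L w + t * L N) 0 := by fun_prop
      simpa [ContinuousAt] using hc.tendsto.mono_left nhdsWithin_le_nhds
    refine ge_of_tendsto h1 ?_
    filter_upwards [self_mem_nhdsWithin] with t ht
    have ht0 : 0 < t := ht
    have := hpos (w + t • N) (by rw [inner_add_right, inner_smul_right, hw, hNN]; linarith)
    simpa using this
  have hLeq : L = L N • innerSL ℝ N := by
    ext v
    have hv : inner ℝ N (v - (inner ℝ N v : ℝ) • N) = 0 := by
      rw [inner_sub_right, inner_smul_right, hNN]; ring
    have h1 := hperp _ hv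
    have h2 := hperp (-(v - (inner ℝ N v : ℝ) • N)) (by rw [inner_neg_right, hv, neg_zero])
    rw [map_neg] at h2
    have h3 : L (v - (inner ℝ N v : ℝ) • N) = 0 := le_antisymm (by linarith) h1
    rw [map_sub, map_smul, sub_eq_zero] at h3
    rw [h3]
    simp [mul_comm]
  refine ⟨hρ0, L N, lt_of_le_of_ne (hpos N (by rw [hNN]; norm_num)) fun h0 => ?_, hLeq⟩
  exact hρ.regular p hρ.mem (by rw [← hL, hLeq, ← h0, zero_smul])

/-- The tangential second derivatives of the distance are at most those of a defining function at
a nearest boundary point, normalized by its gradient. -/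
theorem D2_bdist_le (hopen : IsOpen Ω) (hne : (frontier Ω).Nonempty) (hx : x ∈ Ω)
    (hp : p ∈ frontier Ω) {N : E n} (hN : ‖N‖ = 1) (hxN : x = p + bdist Ω x • N)
    (hd : ContDiffAt ℝ 2 (bdist Ω) x)
    {U : Set (E n)} {ρ : E n → ℝ} (hρ : IsLocalDefiningFunction Ω U ρ p) {c : ℝ} (hc : 0 < c)
    (hρN : fderiv ℝ ρ p = c • innerSL ℝ N) {w : E n} (hw : inner ℝ N w = 0) :
    D2 (bdist Ω) x w w ≤ c⁻¹ * D2 ρ p w w := by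
  have hU : U ∈ 𝓝 p := hρ.isOpen.mem_nhds hρ.mem
  have hC : ContDiffAt ℝ 2 ρ p := hρ.contDiffOn.contDiffAt hU
  have hr := bdist_pos hopen hne hx
  have hρ0 := (fderiv_definingFunction hopen hne hx hp hN hxN hρ).1
  have hNN : inner ℝ N N = (1 : ℝ) := by rw [real_inner_self_eq_norm_sq, hN]; norm_num
  refine le_of_forall_pos_le_add fun ε hε => ?_
  -- With this β the second derivative of ρ along t ↦ p + tw + t²βN is -cε, so ρ ≤ 0 and the curve
  -- stays outside Ω for small t. Its translate through x keeps distance d(x) from it, so d has a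
  -- local maximum along the translate, whence D²d(w,w) + 2β ≤ 0.
  set β := -(c⁻¹ * D2 ρ p w w + ε) / 2 with hβ
  have hmax : IsLocalMax (fun t : ℝ => ρ (p + t • w + t ^ 2 • (β • N))) 0 := by
    refine isLocalMax_of_deriv_deriv_neg ?_ ?_ (contDiffAt_curve hC w _).continuousAt
    · rw [deriv_deriv_curve hC, hρN]
      have : D2 ρ p w w + 2 * (c • innerSL ℝ N) (β • N) = -(c * ε) := by
        simp only [smul_apply, innerSL_apply_apply, inner_smul_right, hNN, smul_eq_mul, hβ]
        field_simp
        ring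
      rw [this]
      exact neg_neg_of_pos (mul_pos hc hε)
    · rw [deriv_curve hC, hρN]
      simp [hw]
  have hdmax : IsLocalMax (fun t : ℝ => bdist Ω (x + t • w + t ^ 2 • (β • N))) 0 := by
    filter_upwards [hmax, tendsto_curve (x := p) w (β • N) hU,
      tendsto_curve (x := x) w (β • N) (hopen.mem_nhds hx)] with t h1 h2 h3
    have h4 : p + t • w + t ^ 2 • (β • N) ∉ Ω := by
      intro h
      have := (hρ.mem_iff _ h2).1 h
      simp only [zero_smul, add_zero, ne_eq, OfNat.ofNat_ne_zero, not_false_eq_true, zero_pow,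
        hρ0] at h1
      linarith
    have h5 := bdist_le_dist_of_notMem hopen hne h3 h4
    have h6 : dist (x + t • w + t ^ 2 • (β • N)) (p + t • w + t ^ 2 • (β • N)) = bdist Ω x := by
      rw [dist_add_right, dist_add_right, dist_eq_norm]
      have : x - p = bdist Ω x • N := by
        conv_lhs => rw [hxN]
        abel
      rw [this, norm_smul, hN, Real.norm_of_nonneg hr.le, mul_one]
    simpa [h6] using h5
  have h := deriv_deriv_nonpos_of_isLocalMax hdmax (contDiffAt_curve hd w _).continuousAt
  rw [deriv_deriv_curve hd,
    fderiv_bdist hp hN hr hxN rfl (hd.differentiableAt (by norm_num))] at h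
  simp only [innerSL_apply_apply, inner_smul_right, hNN, hβ] at h
  linarith

/-- The distance to a mean convex boundary is superharmonic where it is `C²`. -/
theorem exists_normal_bdist (hopen : IsOpen Ω) (hne : (frontier Ω).Nonempty)
    (hC2 : HasC2Boundary Ω) (hmean : MeanConvex Ω) (hx : x ∈ Ω)
    (hd : ContDiffAt ℝ 2 (bdist Ω) x) :
    ∃ N : E n, ‖N‖ = 1 ∧ fderiv ℝ (bdist Ω) x = innerSL ℝ N ∧ D2 (bdist Ω) x N = 0 ∧
      ∑ a : Fin n, D2 (bdist Ω) x (EuclideanSpace.single a 1) (EuclideanSpace.single a 1) ≤ 0 := by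
  obtain ⟨p, hp, N, hN, hxN⟩ := exists_nearest hopen hne hx
  have hfN := fderiv_bdist hp hN (bdist_pos hopen hne hx) hxN rfl
    (hd.differentiableAt (by norm_num))
  have hDN := D2_bdist_apply_normal hopen hne hx hd hN hfN
  obtain ⟨U, ρ, hρ⟩ := hC2 p hp
  have hC : ContDiffAt ℝ 2 ρ p := hρ.contDiffOn.contDiffAt (hρ.isOpen.mem_nhds hρ.mem)
  obtain ⟨c, hc, hρN⟩ := (fderiv_definingFunction hopen hne hx hp hN hxN hρ).2
  have hH := hmean p hp U ρ hρ
  rw [levelMeanCurvature_eq hC hc hN hρN] at hH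
  -- The Hessian comparison is available only orthogonally to N. There the trace of c⁻¹D²ρ is minus
  -- the mean curvature, and D²d has no other part since it annihilates N.
  have hQ := trace_sub_nonneg (c⁻¹ • D2 ρ p - D2 (bdist Ω) x)
    (fun v w => by simp [D2_symm hC v w, D2_symm hd v w]) hN fun w hw => by
      have := D2_bdist_le hopen hne hx hp hN hxN hd hρ hc hρN hw
      simpa using this
  simp only [sub_apply, smul_apply, smul_eq_mul, hDN, zero_apply, Finset.sum_sub_distrib,
    ← Finset.mul_sum] at hQ
  refine ⟨N, hN, hfN, hDN, ?_⟩
  linarith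

end BoundaryDistance

/-! ### Extreme eigenvalues of the Hessian -/

section Eigenvalues

variable {n : ℕ} {f : E n → ℝ} {x : E n}

theorem exists_hessian_eigenbasis (hf : ContDiffAt ℝ 2 f x) :
    ∃ (e : OrthonormalBasis (Fin n) ℝ (E n)) (μ : Fin n → ℝ),
      spectrum ℝ (hessian f x) = range μ ∧ (∀ i, D2 f x (e i) (e i) = μ i) ∧
      ∀ w, D2 f x w w = ∑ i, μ i * inner ℝ (e i) w ^ 2 := by
  have hH : (hessian f x).IsHermitian := by
    ext i j
    simp [hessian_eq hf, D2_symm hf]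
  have hD : ∀ v w : E n, D2 f x v w = ∑ a, v a * (hessian f x *ᵥ w) a := by
    intro v w
    rw [bilin_eq_sum]
    refine Finset.sum_congr rfl fun a _ => ?_
    rw [Matrix.mulVec, dotProduct, Finset.mul_sum]
    refine Finset.sum_congr rfl fun b _ => ?_
    rw [hessian_eq hf]
    ring
  have he : ∀ v i, D2 f x v (hH.eigenvectorBasis i) =
      hH.eigenvalues i * inner ℝ (hH.eigenvectorBasis i) v := by
    intro v i
    rw [hD, hH.mulVec_eigenvectorBasis, PiLp.inner_apply, Finset.mul_sum]
    refine Finset.sum_congr rfl fun a _ => ?_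
    simp
    ring
  refine ⟨hH.eigenvectorBasis, hH.eigenvalues, hH.spectrum_real_eq_range_eigenvalues,
    fun i => ?_, fun w => ?_⟩
  · rw [he, real_inner_self_eq_norm_sq, OrthonormalBasis.norm_eq_one]
    ring
  · have hw := hH.eigenvectorBasis.sum_repr' w
    have h := congrArg (fun v => D2 f x w v) hw
    simp only [map_sum, map_smul, smul_eq_mul, he] at h
    rw [← h]
    exact Finset.sum_congr rfl fun i _ => by ring

theorem sum_sq_inner_basis' (e : OrthonormalBasis (Fin n) ℝ (E n)) (w : E n) :
    ∑ i, inner ℝ (e i) w ^ 2 = ‖w‖ ^ 2 := by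
  simpa using e.sum_sq_norm_inner_right w

theorem D2_le_lamMax (hf : ContDiffAt ℝ 2 f x) (w : E n) :
    D2 f x w w ≤ lamMax f x * ‖w‖ ^ 2 := by
  obtain ⟨e, μ, hμ, -, hw⟩ := exists_hessian_eigenbasis hf
  rw [hw, ← sum_sq_inner_basis' e, Finset.mul_sum, lamMax, hμ]
  exact Finset.sum_le_sum fun i _ => mul_le_mul_of_nonneg_right
    (le_csSup (finite_range μ).bddAbove (mem_range_self i)) (sq_nonneg _)

theorem lamMin_le_D2 (hf : ContDiffAt ℝ 2 f x) (w : E n) :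
    lamMin f x * ‖w‖ ^ 2 ≤ D2 f x w w := by
  obtain ⟨e, μ, hμ, -, hw⟩ := exists_hessian_eigenbasis hf
  rw [hw, ← sum_sq_inner_basis' e, Finset.mul_sum, lamMin, hμ]
  exact Finset.sum_le_sum fun i _ => mul_le_mul_of_nonneg_right
    (csInf_le (finite_range μ).bddBelow (mem_range_self i)) (sq_nonneg _)

theorem abs_D2_le (f : E n → ℝ) (x : E n) {w : E n} (hw : ‖w‖ = 1) :
    |D2 f x w w| ≤ ‖D2 f x‖ := by
  have := (D2 f x).le_opNorm₂ w w
  simpa [hw] using this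

theorem lamMax_le_norm (hf : ContDiffAt ℝ 2 f x) : lamMax f x ≤ ‖D2 f x‖ := by
  obtain ⟨e, μ, hμ, he, -⟩ := exists_hessian_eigenbasis hf
  rw [lamMax, hμ]
  -- A nonnegative bound also covers the empty spectrum for n = 0, where the supremum is 0 by
  -- convention.
  refine Real.sSup_le ?_ (D2 f x).opNorm_nonneg
  rintro _ ⟨i, rfl⟩
  rw [← he]
  exact (le_abs_self _).trans (abs_D2_le f x (e.norm_eq_one i))

theorem neg_norm_le_lamMin (hf : ContDiffAt ℝ 2 f x) : -‖D2 f x‖ ≤ lamMin f x := by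
  obtain ⟨e, μ, hμ, he, -⟩ := exists_hessian_eigenbasis hf
  rw [lamMin, hμ]
  refine Real.le_sInf ?_ (neg_nonpos.2 (D2 f x).opNorm_nonneg)
  rintro _ ⟨i, rfl⟩
  rw [← he]
  exact neg_le_of_abs_le (abs_D2_le f x (e.norm_eq_one i))

end Eigenvalues

/-! ### Functions of class `C²` up to the boundary -/

section UpToBoundary

variable {n : ℕ} {F : Type*} [NormedAddCommGroup F] [NormedSpace ℝ F] {s : Set (E n)}

/-- At boundary points `fderiv` of a function that is `C²` only on the closed set carries no
information; f' is the derivative relative to the closure and agrees with `fderiv` inside. -/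
theorem exists_fderiv_extension (hs : IsOpen s) {f : E n → F} {p : E n} (hp : p ∈ closure s)
    {k : ℕ} (hf : ContDiffWithinAt ℝ (k + 1) f (closure s) p) :
    ∃ f' : E n → E n →L[ℝ] F, HasFDerivWithinAt f (f' p) (closure s) p ∧
      ContDiffWithinAt ℝ k f' (closure s) p ∧
      ∀ᶠ y in 𝓝[s] p, HasFDerivAt f (f' y) y := by
  obtain ⟨u, hu, -, -, f', hf', hc⟩ :=
    (contDiffWithinAt_succ_iff_hasFDerivWithinAt' (by simp)).1 hf
  rw [insert_eq_of_mem hp] at hu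
  refine ⟨f', hf' p (mem_of_mem_nhdsWithin hp hu), hc, ?_⟩
  filter_upwards [nhdsWithin_mono p subset_closure hu, self_mem_nhdsWithin] with y hy hys
  exact (hf' y hy).hasFDerivAt (mem_of_superset (hs.mem_nhds hys) subset_closure)

/-- Local bounds from the extended derivatives, patched by compactness. They make the real suprema
and infima in the constants genuine bounds, since `sSup` of an unbounded set is 0. -/
theorem exists_bound_derivatives (hs : IsOpen s) (hb : Bornology.IsBounded s) {f : E n → ℝ}
    (hf : ContDiffOn ℝ 2 f (closure s)) :
    ∃ C, ∀ x ∈ s, ‖fderiv ℝ f x‖ ≤ C ∧ ‖D2 f x‖ ≤ C := by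
  have hcompact : IsCompact (closure s) := hb.isCompact_closure
  have hloc : ∀ p ∈ closure s, ∃ t ∈ 𝓝[closure s] p,
      ∃ C, ∀ x ∈ s ∩ t, ‖fderiv ℝ f x‖ ≤ C ∧ ‖D2 f x‖ ≤ C := by
    intro p hp
    obtain ⟨f', -, hc, hd⟩ := exists_fderiv_extension hs hp (k := 1) (by
      have := hf p hp
      norm_num
      exact this)
    obtain ⟨f'', -, hc2, hd2⟩ := exists_fderiv_extension hs hp (k := 0) (f := f') (by
      norm_num
      exact_mod_cast hc)
    have h1 : ∀ᶠ y in 𝓝[s] p, ‖f' y‖ < ‖f' p‖ + 1 :=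
      (hc.continuousWithinAt.mono subset_closure).norm.eventually_lt_const (by linarith)
    have h2 : ∀ᶠ y in 𝓝[s] p, ‖f'' y‖ < ‖f'' p‖ + 1 :=
      (hc2.continuousWithinAt.mono subset_closure).norm.eventually_lt_const (by linarith)
    obtain ⟨V, hV, hpV, hVs⟩ := mem_nhdsWithin.1 (((hd.and hd2).and h1).and h2)
    refine ⟨V, mem_nhdsWithin_of_mem_nhds (hV.mem_nhds hpV),
      max (‖f' p‖ + 1) (‖f'' p‖ + 1), fun x hx => ?_⟩
    obtain ⟨⟨⟨hx1, hx2⟩, hx3⟩, hx4⟩ := hVs ⟨hx.2, hx.1⟩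
    have heq : fderiv ℝ f =ᶠ[𝓝 x] f' := by
      filter_upwards [(hV.inter hs).mem_nhds ⟨hx.2, hx.1⟩] with y hy
      exact (hVs hy).1.1.1.fderiv
    have hx5 : D2 f x = f'' x := by rw [D2, heq.fderiv_eq, hx2.fderiv]
    rw [hx5, hx1.fderiv]
    exact ⟨hx3.le.trans (le_max_left _ _), hx4.le.trans (le_max_right _ _)⟩
  have hall := hcompact.induction_on
    (p := fun t => ∃ C, ∀ x ∈ s ∩ t, ‖fderiv ℝ f x‖ ≤ C ∧ ‖D2 f x‖ ≤ C) ⟨0, by simp⟩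
    (fun t t' htt' ⟨C, hC⟩ => ⟨C, fun x hx => hC x ⟨hx.1, htt' hx.2⟩⟩)
    (fun t t' ⟨C, hC⟩ ⟨C', hC'⟩ => ⟨max C C', fun x hx => by
      rcases hx.2 with h | h
      · have := hC x ⟨hx.1, h⟩
        exact ⟨this.1.trans (le_max_left _ _), this.2.trans (le_max_left _ _)⟩
      · have := hC' x ⟨hx.1, h⟩
        exact ⟨this.1.trans (le_max_right _ _), this.2.trans (le_max_right _ _)⟩⟩) hloc
  obtain ⟨C, hC⟩ := hall
  exact ⟨C, fun x hx => hC x ⟨hx, subset_closure hx⟩⟩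

theorem norm_fderiv_le_gradSup (hs : IsOpen s) (hb : Bornology.IsBounded s) {f : E n → ℝ}
    (hf : ContDiffOn ℝ 2 f (closure s)) {x : E n} (hx : x ∈ s) :
    ‖fderiv ℝ f x‖ ≤ gradSup s f := by
  obtain ⟨C, hC⟩ := exists_bound_derivatives hs hb hf
  refine le_csSup ⟨C, ?_⟩ (mem_image_of_mem _ hx)
  rintro _ ⟨y, hy, rfl⟩
  exact (hC y hy).1

theorem gradSup_nonneg (f : E n → ℝ) : 0 ≤ gradSup s f := by
  refine Real.sSup_nonneg ?_
  rintro _ ⟨y, -, rfl⟩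
  exact norm_nonneg _

theorem isOpen_collar (hs : IsOpen s) (d : ℝ) : IsOpen (collar s d) :=
  hs.inter (isOpen_lt bdist_lipschitz.continuous continuous_const)

theorem collar_subset (d : ℝ) : collar s d ⊆ s := fun _ hx => hx.1

theorem contDiffAt_of_closure (hs : IsOpen s) {f : E n → F} (hf : ContDiffOn ℝ 2 f (closure s))
    {x : E n} (hx : x ∈ s) : ContDiffAt ℝ 2 f x :=
  hf.contDiffAt (mem_of_superset (hs.mem_nhds hx) subset_closure)

theorem D2_le_lamPlus (hs : IsOpen s) (hb : Bornology.IsBounded s) {f : E n → ℝ} {d : ℝ}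
    (hf : ContDiffOn ℝ 2 f (closure (collar s d))) {x : E n} (hx : x ∈ collar s d) (w : E n) :
    D2 f x w w ≤ lamPlus s d f * ‖w‖ ^ 2 := by
  have hcol := isOpen_collar hs d
  obtain ⟨C, hC⟩ := exists_bound_derivatives hcol (hb.subset (collar_subset d)) hf
  refine (D2_le_lamMax (contDiffAt_of_closure hcol hf hx) w).trans
    (mul_le_mul_of_nonneg_right (le_max_of_le_right (le_csSup ⟨C, ?_⟩ (mem_image_of_mem _ hx)))
      (sq_nonneg _))
  rintro _ ⟨y, hy, rfl⟩
  exact (lamMax_le_norm (contDiffAt_of_closure hcol hf hy)).trans (hC y hy).2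

theorem neg_lamMinus_le_D2 (hs : IsOpen s) (hb : Bornology.IsBounded s) {d : ℝ}
    (hf : ContDiffOn ℝ 2 (bdist s) (closure (collar s d))) {x : E n} (hx : x ∈ collar s d)
    (w : E n) : -lamMinus s d * ‖w‖ ^ 2 ≤ D2 (bdist s) x w w := by
  have hcol := isOpen_collar hs d
  obtain ⟨C, hC⟩ := exists_bound_derivatives hcol (hb.subset (collar_subset d)) hf
  refine le_trans (mul_le_mul_of_nonneg_right ?_ (sq_nonneg _))
    (lamMin_le_D2 (contDiffAt_of_closure hcol hf hx) w)
  have h1 : sInf (lamMin (bdist s) '' collar s d) ≤ lamMin (bdist s) x := by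
    refine csInf_le ⟨-C, ?_⟩ (mem_image_of_mem _ hx)
    rintro _ ⟨y, hy, rfl⟩
    have := neg_norm_le_lamMin (contDiffAt_of_closure hcol hf hy)
    linarith [(hC y hy).2]
  have h2 : -sInf (lamMin (bdist s) '' collar s d) ≤ lamMinus s d := le_max_right _ _
  linarith

end UpToBoundary

/-! ### Oscillation and intrinsic diameter -/

section Oscillation

variable {n : ℕ} {Ω : Set (E n)} {f : E n → ℝ} {K : ℝ}

/-- The curve is merely continuous, so f is not differentiated along it. A fine subdivision puts
consecutive points in balls inside Ω, the mean value inequality applies to each chord, and the chord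
lengths add up to at most the variation. -/
theorem abs_sub_le_of_curve (hopen : IsOpen Ω) (hf : ∀ x ∈ Ω, DifferentiableAt ℝ f x)
    (hK : ∀ x ∈ Ω, ‖fderiv ℝ f x‖ ≤ K) (hK0 : 0 ≤ K) {γ : ℝ → E n}
    (hγ : ContinuousOn γ (Icc 0 1)) (hγΩ : MapsTo γ (Icc 0 1) Ω) {V : ℝ}
    (hV0 : 0 ≤ V) (hV : eVariationOn γ (Icc 0 1) ≤ ENNReal.ofReal V) :
    |f (γ 1) - f (γ 0)| ≤ K * V := by
  obtain ⟨δ, hδ, hsub⟩ := (isCompact_Icc.image_of_continuousOn hγ).exists_thickening_subset_open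
    hopen hγΩ.image_subset
  obtain ⟨η, hη, huc⟩ := Metric.uniformContinuousOn_iff.1
    (isCompact_Icc.uniformContinuousOn_of_continuous hγ) δ hδ
  obtain ⟨N, hN⟩ := exists_nat_one_div_lt hη
  set a : ℕ → ℝ := fun i => i / (N + 1) with ha
  have hN1 : (0 : ℝ) < N + 1 := by positivity
  have haI : ∀ i ≤ N + 1, a i ∈ Icc (0 : ℝ) 1 := fun i hi => by
    refine ⟨by positivity, (div_le_one hN1).2 ?_⟩
    exact_mod_cast hi
  have hmono : MonotoneOn a (Iic (N + 1)) := fun i _ j _ hij => by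
    simp only [ha]
    gcongr
  have hstep : ∀ i ∈ Finset.range (N + 1),
      |f (γ (a (i + 1))) - f (γ (a i))| ≤ K * dist (γ (a (i + 1))) (γ (a i)) := by
    intro i hi
    have hi' := Finset.mem_range.1 hi
    have h1 := haI i (by omega)
    have h2 := haI (i + 1) (by omega)
    have hball : Metric.ball (γ (a i)) δ ⊆ Ω := fun y hy =>
      hsub (Metric.mem_thickening_iff.2 ⟨γ (a i), mem_image_of_mem _ h1, hy⟩)
    have hd : dist (γ (a (i + 1))) (γ (a i)) < δ := by
      refine huc _ h2 _ h1 ?_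
      have : a (i + 1) - a i = 1 / (N + 1) := by simp only [ha]; push_cast; ring
      rw [Real.dist_eq, this, abs_of_pos (by positivity)]
      exact hN
    rw [dist_eq_norm, ← Real.norm_eq_abs]
    exact (convex_ball (γ (a i)) δ).norm_image_sub_le_of_norm_fderiv_le
      (fun y hy => hf y (hball hy)) (fun y hy => hK y (hball hy)) (Metric.mem_ball_self hδ)
      (Metric.mem_ball.2 hd)
  have hsum : ∑ i ∈ Finset.range (N + 1), dist (γ (a (i + 1))) (γ (a i)) ≤ V := by
    have h := (eVariationOn.sum_le_of_monotoneOn_Iic hmono haI (f := γ)).trans hV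
    simp_rw [edist_dist] at h
    rw [← ENNReal.ofReal_sum_of_nonneg fun i _ => dist_nonneg] at h
    exact (ENNReal.ofReal_le_ofReal_iff hV0).1 h
  have h0 : a 0 = 0 := by simp [ha]
  have h1 : a (N + 1) = 1 := by simp only [ha]; push_cast; exact div_self hN1.ne'
  calc |f (γ 1) - f (γ 0)| = |∑ i ∈ Finset.range (N + 1), (f (γ (a (i + 1))) - f (γ (a i)))| := by
        rw [Finset.sum_range_sub (fun i => f (γ (a i))), h0, h1]
    _ ≤ ∑ i ∈ Finset.range (N + 1), |f (γ (a (i + 1))) - f (γ (a i))| :=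
        Finset.abs_sum_le_sum_abs _ _
    _ ≤ ∑ i ∈ Finset.range (N + 1), K * dist (γ (a (i + 1))) (γ (a i)) :=
        Finset.sum_le_sum hstep
    _ ≤ K * V := by
        rw [← Finset.mul_sum]
        exact mul_le_mul_of_nonneg_left hsum hK0

theorem abs_sub_le_mul_intrinsicDiam (hopen : IsOpen Ω) (hf : ∀ x ∈ Ω, DifferentiableAt ℝ f x)
    (hK : ∀ x ∈ Ω, ‖fderiv ℝ f x‖ ≤ K) (hK0 : 0 ≤ K) {l : ℝ}
    (hl : intrinsicDiam Ω ≤ ENNReal.ofReal l) {x y : E n} (hx : x ∈ Ω) (hy : y ∈ Ω) :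
    |f y - f x| ≤ K * max l 0 := by
  have hxy : intrinsicEDist Ω x y ≤ ENNReal.ofReal (max l 0) := by
    rw [show ENNReal.ofReal (max l 0) = ENNReal.ofReal l by simp [ENNReal.ofReal_max]]
    refine le_trans ?_ hl
    exact le_iSup₂_of_le x hx (le_iSup₂_of_le y hy le_rfl)
  -- The infimum of lengths need not be attained, so a curve longer by less than ε is used.
  have hε : ∀ ε > 0, |f y - f x| ≤ K * (max l 0 + ε) := by
    intro ε hε
    have hlt : intrinsicEDist Ω x y < ENNReal.ofReal (max l 0 + ε) :=
      hxy.trans_lt ((ENNReal.ofReal_lt_ofReal_iff (by positivity)).2 (by linarith))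
    simp only [intrinsicEDist, iInf_lt_iff] at hlt
    obtain ⟨γ, ⟨hγ, hγΩ, h0, h1⟩, hV⟩ := hlt
    have := abs_sub_le_of_curve hopen hf hK hK0 hγ hγΩ (by positivity) hV.le
    rwa [h0, h1] at this
  have hlim : Tendsto (fun ε : ℝ => K * (max l 0 + ε)) (𝓝[>] 0) (𝓝 (K * max l 0)) := by
    have hc : ContinuousAt (fun ε : ℝ => K * (max l 0 + ε)) 0 := by fun_prop
    simpa [ContinuousAt] using hc.tendsto.mono_left nhdsWithin_le_nhds
  exact ge_of_tendsto hlim (by filter_upwards [self_mem_nhdsWithin] with ε h using hε ε h)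

/-- `ENNReal.ofReal` sends negative l to 0; then a linear coordinate would be constant on an open
set. Nonnegativity of l is what gives κ ≥ 1. -/
theorem nonneg_of_intrinsicDiam_le (hn : 0 < n) (hopen : IsOpen Ω) (hne : Ω.Nonempty) {l : ℝ}
    (hl : intrinsicDiam Ω ≤ ENNReal.ofReal l) : 0 ≤ l := by
  by_contra! hneg
  obtain ⟨x, hx⟩ := hne
  obtain ⟨ε, hε, hball⟩ := Metric.isOpen_iff.1 hopen x hx
  set e : E n := EuclideanSpace.single ⟨0, hn⟩ 1 with he
  have hen : ‖e‖ = 1 := by simp [he]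
  have hy : x + (ε / 2) • e ∈ Ω := hball (by
    rw [Metric.mem_ball, dist_eq_norm, add_sub_cancel_left, norm_smul, hen,
      Real.norm_of_nonneg (by positivity)]
    linarith)
  have h := abs_sub_le_mul_intrinsicDiam (f := innerSL ℝ e) (K := 1) hopen
    (fun y _ => (innerSL ℝ e).differentiableAt)
    (fun y _ => by rw [ContinuousLinearMap.fderiv, innerSL_apply_norm, hen]) zero_le_one hl hx hy
  rw [max_eq_right hneg.le, mul_zero, ← map_sub, add_sub_cancel_left, map_smul,
    innerSL_apply_apply, real_inner_self_eq_norm_sq, hen] at h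
  have := abs_nonpos_iff.1 h
  simp only [one_pow, smul_eq_mul, mul_one] at this
  linarith

end Oscillation

/-! ### The barrier inequality -/

section Barrier

variable {n m : ℕ}

/-- The linearized operator `g^{ij} b_ij` of the graph of `u`, applied to a function `b`. -/
noncomputable def metricTrace (u : E n → E m) (b : E n → ℝ) (x : E n) : ℝ :=
  ∑ i, ∑ j, (metric u x)⁻¹ i j * hessian b x i j

theorem metricTrace_eq {u : E n → E m} {b : E n → ℝ} {x : E n} (hb : ContDiffAt ℝ 2 b x) :
    metricTrace u b x = ∑ i, ∑ j, (metric u x)⁻¹ i j *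
      D2 b x (EuclideanSpace.single i 1) (EuclideanSpace.single j 1) := by
  simp only [metricTrace, hessian_eq hb]

theorem one_add_le_prod {ι : Type*} [Fintype ι] [DecidableEq ι] {a : ι → ℝ} (ha : ∀ i, 1 ≤ a i)
    (i : ι) : a i ≤ ∏ j, a j := by
  rw [← Finset.mul_prod_erase _ _ (Finset.mem_univ i)]
  have h : 1 ≤ ∏ j ∈ Finset.univ.erase i, a j :=
    Finset.prod_induction a (fun t => 1 ≤ t) (fun s t hs ht => one_le_mul_of_one_le_of_one_le hs ht)
      le_rfl fun j _ => ha j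
  exact le_mul_of_one_le_right (zero_le_one.trans (ha i)) h

/-- The determinant is the product of all 1 + λⱼ², each factor at least 1. -/
theorem one_add_sq_singularValues_le_det {u : E n → E m} {x : E n}
    (hu : DifferentiableAt ℝ u x) (i : Fin n) :
    1 + (fderiv ℝ u x).toLinearMap.singularValues i ^ 2 ≤ (metric u x).det := by
  obtain ⟨e, -, -, hdet⟩ := exists_singular_basis hu
  rw [hdet]
  exact one_add_le_prod (a := fun i : Fin n => 1 + (fderiv ℝ u x).toLinearMap.singularValues i ^ 2)
    (fun i => by nlinarith [sq_nonneg ((fderiv ℝ u x).toLinearMap.singularValues i)]) i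

theorem hasFDerivAt_component {u : E n → E m} {x : E n} (hu : DifferentiableAt ℝ u x)
    (α : Fin m) :
    HasFDerivAt (fun y => u y α) ((EuclideanSpace.proj α : E m →L[ℝ] ℝ).comp (fderiv ℝ u x)) x :=
  (EuclideanSpace.proj (𝕜 := ℝ) α).hasFDerivAt.comp x hu.hasFDerivAt

theorem sq_singularValues_le_sum {u : E n → E m} {x : E n} (hu : DifferentiableAt ℝ u x)
    (i : Fin n) : (fderiv ℝ u x).toLinearMap.singularValues i ^ 2 ≤
      ∑ α, ‖fderiv ℝ (fun y => u y α) x‖ ^ 2 := by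
  obtain ⟨e, he, -, -⟩ := exists_singular_basis hu
  rw [← he, EuclideanSpace.norm_sq_eq]
  refine Finset.sum_le_sum fun α _ => pow_le_pow_left₀ (norm_nonneg _) ?_ 2
  have h := (fderiv ℝ (fun y => u y α) x).le_opNorm (e i)
  rw [e.norm_eq_one, mul_one, (hasFDerivAt_component hu α).fderiv] at h
  rw [(hasFDerivAt_component hu α).fderiv]
  exact h

/-- The function `v ∘ d + φ` is a strict supersolution of the linearized operator, if the slope
`v'` is large and controls the differential of the graph. -/
theorem metricTrace_barrier_neg {Ω : Set (E n)} {u : E n → E m} {x : E n}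
    (hn : 2 ≤ n) (hopen : IsOpen Ω) (hne : (frontier Ω).Nonempty) (hC2 : HasC2Boundary Ω)
    (hmean : MeanConvex Ω) (hx : x ∈ Ω)
    (hd : ContDiffAt ℝ 2 (bdist Ω) x) {c : ℝ} (hc : 0 ≤ c)
    (hdc : ∀ w, -c * ‖w‖ ^ 2 ≤ D2 (bdist Ω) x w w)
    {φ : E n → ℝ} (hφ : ContDiffAt ℝ 2 φ x) {Λ : ℝ} (hΛ : 0 ≤ Λ)
    (hφΛ : ∀ w, D2 φ x w w ≤ Λ * ‖w‖ ^ 2)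
    (hu : DifferentiableAt ℝ u x)
    (harea : ∀ i j : Fin n, i ≠ j → (fderiv ℝ u x).toLinearMap.singularValues i *
      (fderiv ℝ u x).toLinearMap.singularValues j ≤ 1)
    {v v' : ℝ → ℝ} {ν : ℝ} (hν : ν = 16 * n * (Λ + 1))
    (hv : ∀ᶠ s in 𝓝 (bdist Ω x), HasDerivAt v (v' s) s)
    (hv' : HasDerivAt v' (-(ν * v' (bdist Ω x) ^ 2)) (bdist Ω x))
    (hvC : ContDiffAt ℝ 2 v (bdist Ω x))
    (hpos : 0 < v' (bdist Ω x)) (hlarge : 2 * (n + 1) * c ≤ ν * v' (bdist Ω x))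
    (hs : ∀ i : Fin n, 1 + (fderiv ℝ u x).toLinearMap.singularValues i ^ 2 ≤
      8 * v' (bdist Ω x) ^ 2) :
    metricTrace u (fun y => v (bdist Ω y) + φ y) x < 0 := by
  have hvd : ContDiffAt ℝ 2 (fun y => v (bdist Ω y)) x := hvC.comp x hd
  obtain ⟨N, hN, hdN, hDN, htr⟩ := exists_normal_bdist hopen hne hC2 hmean hx hd
  obtain ⟨e, -, hB, -⟩ := exists_singular_basis hu
  rw [metricTrace_eq (hvd.add hφ), hB, D2_add hvd hφ]
  set p := v' (bdist Ω x) with hp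
  set s : Fin n → ℝ := fun i => (fderiv ℝ u x).toLinearMap.singularValues i with hsdef
  have hs0 : ∀ i, 0 ≤ s i := fun i => LinearMap.singularValues_nonneg _ _
  have hG0 : ∀ i, 0 < (1 + s i ^ 2)⁻¹ := fun i => by positivity
  have hG1 : ∀ i, (1 + s i ^ 2)⁻¹ ≤ 1 := fun i =>
    inv_le_one_of_one_le₀ (by nlinarith [sq_nonneg (s i)])
  set q := ∑ i, (1 + s i ^ 2)⁻¹ * inner ℝ (e i) N ^ 2 with hq
  have hq8 : (8 * p ^ 2)⁻¹ ≤ q := inv_le_sum_inv_mul_sq e hN hs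
  have hd1 : ∑ i, (1 + s i ^ 2)⁻¹ * D2 (bdist Ω) x (e i) (e i) ≤ c * ((n + 1) * q) :=
    sum_inv_mul_bilin_le e hs0 harea (D2_symm hd) hN hDN (by rwa [sum_basis_bilin]) hc hdc
  have hφ1 : ∑ i, (1 + s i ^ 2)⁻¹ * D2 φ x (e i) (e i) ≤ n * Λ := by
    calc _ ≤ ∑ _i : Fin n, Λ := Finset.sum_le_sum fun i _ => by
          have := hφΛ (e i)
          rw [e.norm_eq_one] at this
          nlinarith [hG0 i, hG1 i]
      _ = n * Λ := by simp
  have hsum : ∑ i, (1 + s i ^ 2)⁻¹ * (D2 (fun y => v (bdist Ω y)) x + D2 φ x) (e i) (e i) =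
      p * ∑ i, (1 + s i ^ 2)⁻¹ * D2 (bdist Ω) x (e i) (e i) - ν * p ^ 2 * q +
        ∑ i, (1 + s i ^ 2)⁻¹ * D2 φ x (e i) (e i) := by
    rw [hq, Finset.mul_sum, Finset.mul_sum, ← Finset.sum_sub_distrib, ← Finset.sum_add_distrib]
    refine Finset.sum_congr rfl fun i _ => ?_
    rw [add_apply, add_apply, D2_comp_real hv hv' hd, hdN, innerSL_apply_apply, real_inner_comm]
    ring
  rw [hsum]
  have hn0 : (0 : ℝ) < n := by positivity
  have hν0 : 0 < ν := by rw [hν]; positivity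
  have hq0 : 0 < q := lt_of_lt_of_le (by positivity) hq8
  have h1 : 1 ≤ 8 * p ^ 2 * q := by
    have := mul_le_mul_of_nonneg_left hq8 (by positivity : 0 ≤ 8 * p ^ 2)
    rwa [mul_inv_cancel₀ (by positivity)] at this
  -- Half of the concavity term νp²q pays for the distance Hessian.
  have h2 : p * (c * ((n + 1) * q)) ≤ ν * p ^ 2 * q / 2 := by
    have := mul_le_mul_of_nonneg_left hlarge (by positivity : 0 ≤ p * q / 2)
    nlinarith
  have h3 := mul_le_mul_of_nonneg_left hd1 hpos.le
  -- The other half pays for φ: since 8p²q ≥ 1, it is at least ν/16 = n(Λ + 1). The summand 1 in ν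
  -- makes the final inequality strict.
  have h4 : n * (Λ + 1) ≤ ν * p ^ 2 * q / 2 := by
    have := mul_le_mul_of_nonneg_left h1 (by positivity : 0 ≤ n * (Λ + 1))
    rw [hν]
    nlinarith
  nlinarith

end Barrier

/-! ### The logarithmic barrier -/

section LogBarrier

/-- The barrier profile `s ↦ ν⁻¹ log (1 + κ s / d₀)`. -/
noncomputable def logBarrier (ν κ d₀ s : ℝ) : ℝ := Real.log (1 + κ / d₀ * s) / ν

/-- The derivative of the barrier profile. -/
noncomputable def logBarrierSlope (ν κ d₀ s : ℝ) : ℝ := κ / (ν * (d₀ + κ * s))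

variable {ν κ d₀ s : ℝ}

theorem hasDerivAt_logBarrier (hν : 0 < ν) (hκ : 0 < κ) (hd₀ : 0 < d₀) (hs : 0 < d₀ + κ * s) :
    HasDerivAt (logBarrier ν κ d₀) (logBarrierSlope ν κ d₀ s) s := by
  have h0 : 1 + κ / d₀ * s ≠ 0 := by
    have : 1 + κ / d₀ * s = (d₀ + κ * s) / d₀ := by field_simp
    rw [this]
    positivity
  have h1 : HasDerivAt (fun s => 1 + κ / d₀ * s) (κ / d₀) s := by
    simpa using ((hasDerivAt_id s).const_mul (κ / d₀)).const_add 1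
  have h2 := (h1.log h0).div_const ν
  refine h2.congr_deriv ?_
  rw [logBarrierSlope]
  have : 1 + κ / d₀ * s = (d₀ + κ * s) / d₀ := by field_simp
  rw [this]
  field_simp

/-- The equation v'' = -νv'² is the reason for the logarithm. -/
theorem hasDerivAt_logBarrierSlope (hν : 0 < ν) (hs : 0 < d₀ + κ * s) :
    HasDerivAt (logBarrierSlope ν κ d₀) (-(ν * logBarrierSlope ν κ d₀ s ^ 2)) s := by
  have h1 : HasDerivAt (fun s => ν * (d₀ + κ * s)) (ν * κ) s := by
    simpa using (((hasDerivAt_id s).const_mul κ).const_add d₀).const_mul ν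
  have h2 := (h1.inv (by positivity)).const_mul κ
  refine (h2.congr_of_eventuallyEq (Eventually.of_forall fun t => ?_)).congr_deriv ?_
  · simp [logBarrierSlope, div_eq_mul_inv]
  · rw [logBarrierSlope]
    field_simp

theorem contDiffAt_logBarrier (hκ : 0 < κ) (hd₀ : 0 < d₀) (hs : 0 ≤ s) :
    ContDiffAt ℝ 2 (logBarrier ν κ d₀) s := by
  have h : ContDiffAt ℝ 2 (fun s => 1 + κ / d₀ * s) s := by fun_prop
  exact (h.log (by positivity)).div_const ν

theorem logBarrierSlope_pos (hν : 0 < ν) (hκ : 0 < κ) (hd₀ : 0 < d₀) (hs : 0 ≤ s) :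
    0 < logBarrierSlope ν κ d₀ s := by
  unfold logBarrierSlope
  positivity

/-- The slope decreases in s; at s = d₀ its multiple by ν is κ/(d₀(1 + κ)), and κ ≥ 1. -/
theorem one_div_le_logBarrierSlope (hν : 0 < ν) (hκ : 1 ≤ κ) (hd₀ : 0 < d₀) (hs : 0 ≤ s)
    (hsd : s ≤ d₀) : 1 / (2 * d₀) ≤ ν * logBarrierSlope ν κ d₀ s := by
  have h : ν * logBarrierSlope ν κ d₀ s = κ / (d₀ + κ * s) := by
    rw [logBarrierSlope]
    field_simp
  rw [h, div_le_div_iff₀ (by positivity) (by positivity)]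
  nlinarith

/-- For κs ≤ d₀ the slope is at least κ/(2νd₀), half its value at 0. The left side is exactly the
assumed bound for det g. -/
theorem le_logBarrierSlope_near (hν : 0 < ν) (hκ : 1 ≤ κ) (hd₀ : 0 < d₀) (hs : 0 ≤ s)
    (hsd : s ≤ d₀ / κ) :
    2 * κ ^ 2 / (d₀ ^ 2 * ν ^ 2) ≤ 8 * logBarrierSlope ν κ d₀ s ^ 2 := by
  have hκ0 : 0 < κ := by linarith
  have h1 : κ * s ≤ d₀ := by rwa [le_div_iff₀ hκ0, mul_comm] at hsd
  have h2 : κ / (ν * (d₀ + d₀)) ≤ logBarrierSlope ν κ d₀ s := by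
    unfold logBarrierSlope
    gcongr
  have h3 := pow_le_pow_left₀ (by positivity) h2 2
  calc 2 * κ ^ 2 / (d₀ ^ 2 * ν ^ 2) = 8 * (κ / (ν * (d₀ + d₀))) ^ 2 := by
        field_simp
        norm_num
    _ ≤ _ := by linarith

theorem logBarrier_nonneg (hν : 0 < ν) (hκ : 0 < κ) (hd₀ : 0 < d₀) (hs : 0 ≤ s) :
    0 ≤ logBarrier ν κ d₀ s := by
  have : 0 ≤ κ / d₀ * s := by positivity
  exact div_nonneg (Real.log_nonneg (by linarith)) hν.le

theorem logBarrier_le (hν : 0 < ν) (hκ : 0 < κ) (hd₀ : 0 < d₀) (hs : 0 ≤ s) :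
    logBarrier ν κ d₀ s ≤ κ / (d₀ * ν) * s := by
  have h : Real.log (1 + κ / d₀ * s) ≤ κ / d₀ * s := by
    have := Real.log_le_sub_one_of_pos (show 0 < 1 + κ / d₀ * s by positivity)
    linarith
  calc logBarrier ν κ d₀ s ≤ κ / d₀ * s / ν := by
        unfold logBarrier
        gcongr
    _ = _ := by field_simp

/-- This fixes κ: v(d₀) = ν⁻¹ log(1 + κ) exceeds ν⁻¹ log κ, which is the oscillation bound a. -/
theorem le_logBarrier_self {a : ℝ} (hν : 0 < ν) (hd₀ : 0 < d₀) (hκ : κ = Real.exp (ν * a)) :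
    a ≤ logBarrier ν κ d₀ d₀ := by
  have hκ0 : 0 < κ := by rw [hκ]; exact Real.exp_pos _
  rw [logBarrier, div_mul_cancel₀ _ hd₀.ne', le_div_iff₀ hν, mul_comm a]
  calc ν * a = Real.log κ := by rw [hκ, Real.log_exp]
    _ ≤ _ := Real.log_le_log hκ0 (by linarith)

end LogBarrier

/-! ### Comparison for elliptic and parabolic solutions -/

section Comparison

variable {n m : ℕ}

theorem metricTrace_nonpos_of_isLocalMax {u : E n → E m} {b : E n → ℝ} {x : E n}
    (hu : DifferentiableAt ℝ u x) (hb : ContDiffAt ℝ 2 b x) (hmax : IsLocalMax b x) :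
    metricTrace u b x ≤ 0 := by
  obtain ⟨e, -, hB, -⟩ := exists_singular_basis hu
  rw [metricTrace_eq hb, hB]
  refine Finset.sum_nonpos fun i _ => mul_nonpos_of_nonneg_of_nonpos (by positivity)
    (D2_nonpos_of_isLocalMax hb hmax _)

theorem metricTrace_const_mul_sub {u : E n → E m} {a b : E n → ℝ} {x : E n} (σ : ℝ)
    (ha : ContDiffAt ℝ 2 a x) (hb : ContDiffAt ℝ 2 b x) :
    metricTrace u (fun y => σ * a y - b y) x = σ * metricTrace u a x - metricTrace u b x := by
  have hσa : ContDiffAt ℝ 2 (fun y => σ * a y) x := contDiffAt_const.mul ha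
  rw [metricTrace_eq (hσa.sub hb), metricTrace_eq ha, metricTrace_eq hb, D2_sub hσa hb,
    D2_const_mul σ ha, Finset.mul_sum, ← Finset.sum_sub_distrib]
  refine Finset.sum_congr rfl fun i _ => ?_
  rw [Finset.mul_sum, ← Finset.sum_sub_distrib]
  refine Finset.sum_congr rfl fun j _ => ?_
  simp only [sub_apply, smul_apply, smul_eq_mul]
  ring

theorem contDiffAt_norm_sq_mul (ε : ℝ) (x : E n) :
    ContDiffAt ℝ 2 (fun y : E n => ε * ‖y‖ ^ 2) x :=
  contDiffAt_const.mul (contDiff_norm_sq ℝ).contDiffAt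

/-- Supplies the strict inequality that excludes interior maxima in the maximum principle. -/
theorem metricTrace_norm_sq_neg (hn : 0 < n) {u : E n → E m} {x : E n}
    (hu : DifferentiableAt ℝ u x) {ε : ℝ} (hε : 0 < ε) :
    metricTrace u (fun y => -ε * ‖y‖ ^ 2) x < 0 := by
  obtain ⟨e, -, hB, -⟩ := exists_singular_basis hu
  have hnorm : ContDiffAt ℝ 2 (fun y : E n => ‖y‖ ^ 2) x := (contDiff_norm_sq ℝ).contDiffAt
  rw [metricTrace_eq (contDiffAt_norm_sq_mul _ x), hB, D2_const_mul _ hnorm]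
  have hD : ∀ w : E n, D2 (fun y : E n => ‖y‖ ^ 2) x w w = 2 * ‖w‖ ^ 2 := by
    intro w
    have h1 : fderiv ℝ (fun y : E n => ‖y‖ ^ 2) = fun y => (2 : ℝ) • innerSL ℝ y := by
      funext y
      rw [(hasStrictFDerivAt_norm_sq y).hasFDerivAt.fderiv]
      ext v
      simp
    have h2 := ((innerSL ℝ (E := E n)).hasFDerivAt (x := x)).const_smul (2 : ℝ)
    rw [D2, h1]
    erw [h2.fderiv]
    simp only [smul_apply, smul_eq_mul]
    exact congrArg (2 * ·) (real_inner_self_eq_norm_sq w)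
  have : Nonempty (Fin n) := ⟨⟨0, hn⟩⟩
  refine Finset.sum_neg (fun i _ => ?_) Finset.univ_nonempty
  refine mul_neg_of_pos_of_neg (by positivity) ?_
  simp only [smul_apply, hD, e.norm_eq_one, smul_eq_mul]
  linarith

/-- Common features of solutions of the minimal surface system (constant in time) and of its flow
on `[0, t₀]`: each point `(t, x)` either carries the value `ψ x`, or `g^{ij} f_ij` has the sign of
the time derivative at a maximum over the whole time interval. -/
structure IsWeakFlow (Ω : Set (E n)) (t₀ : ℝ) (ψ : E n → E m) (f : ℝ → E n → E m) : Prop where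
  continuousOn : ContinuousOn (fun p : ℝ × E n => f p.1 p.2) (Icc 0 t₀ ×ˢ closure Ω)
  boundary : ∀ t ∈ Icc 0 t₀, ∀ x ∈ frontier Ω, f t x = ψ x
  interior : ∀ t ∈ Icc 0 t₀, ∀ x ∈ Ω, f t x = ψ x ∨ (ContDiffAt ℝ 2 (f t) x ∧
    ∀ (α : Fin m) (σ : ℝ), (∀ s ∈ Icc 0 t₀, σ * f s x α ≤ σ * f t x α) →
      0 ≤ σ * graphOperator (f t) α x)

variable {Ω : Set (E n)} {ψ : E n → E m}

/-- With t₀ = 0 the condition on maxima in time is vacuous, and the equation gives zero. -/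
theorem IsMinimalGraph.isWeakFlow (hopen : IsOpen Ω) {u : E n → E m}
    (hu : IsMinimalGraph Ω ψ u) : IsWeakFlow Ω 0 ψ (fun _ => u) where
  continuousOn := hu.continuousOn.comp continuousOn_snd fun p hp => hp.2
  boundary _ _ := hu.boundary
  interior _ _ x hx := Or.inr ⟨hu.contDiffOn.contDiffAt (hopen.mem_nhds hx), fun α σ _ => by
    rw [hu.equation x hx α, mul_zero]⟩

/-- The left derivative at the maximum of a function over an interval to the left. -/
theorem nonneg_of_hasDerivAt_of_max {g : ℝ → ℝ} {g' a t : ℝ} (hat : a < t)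
    (hg : HasDerivAt g g' t) (hmax : ∀ s ∈ Icc a t, g s ≤ g t) : 0 ≤ g' := by
  refine ge_of_tendsto hg.tendsto_slope_zero_left ?_
  have h1 : ∀ᶠ s : ℝ in 𝓝[<] 0, a - t < s :=
    (eventually_gt_nhds (by linarith)).filter_mono nhdsWithin_le_nhds
  filter_upwards [h1, self_mem_nhdsWithin] with s hs hs0
  have hs0' : s < 0 := hs0
  have := hmax (t + s) ⟨by linarith, by linarith⟩
  exact mul_nonneg_of_nonpos_of_nonpos (inv_nonpos.2 hs0'.le) (by linarith)

theorem IsGraphFlow.isWeakFlow (hopen : IsOpen Ω) {T : ℝ} {f : ℝ → E n → E m}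
    (hf : IsGraphFlow Ω T ψ f) {t₀ : ℝ} (ht₀ : t₀ ∈ Ico 0 T) : IsWeakFlow Ω t₀ ψ f where
  continuousOn := hf.continuousOn.mono
    (prod_mono (fun _ ht => ⟨ht.1, ht.2.trans_lt ht₀.2⟩) subset_rfl)
  boundary t ht := hf.boundary t ⟨ht.1, ht.2.trans_lt ht₀.2⟩
  interior t ht x hx := by
    rcases ht.1.eq_or_lt with h0 | h0
    · left
      rw [← h0]
      exact hf.initial x hx
    · right
      have ht' : t ∈ Ioo 0 T := ⟨h0, ht.2.trans_lt ht₀.2⟩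
      -- The maximum may occur at the final time, so only times s ≤ t are used.
      refine ⟨(hf.contDiffOn t ht').contDiffAt (hopen.mem_nhds hx), fun α σ hmax => ?_⟩
      exact nonneg_of_hasDerivAt_of_max h0 ((hf.equation t ht' x hx α).const_mul σ)
        fun s hs => hmax s ⟨hs.1, hs.2.trans ht.2⟩

/-- Where `σ f^α - b` is maximal over `[0, t₀] × C`, in a subdomain `O` either `f` has its boundary
value or the differentials of `σ f^α` and `b` agree and `g^{ij} b_ij` is nonnegative. -/
theorem IsWeakFlow.exists_touching {t₀ : ℝ} {f : ℝ → E n → E m} (hf : IsWeakFlow Ω t₀ ψ f)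
    (ht₀ : 0 ≤ t₀) {C O : Set (E n)} (hC : IsCompact C) (hCne : C.Nonempty)
    (hCΩ : C ⊆ closure Ω) (hO : IsOpen O) (hOC : O ⊆ C) (hOΩ : O ⊆ Ω) {b : E n → ℝ}
    (hbc : ContinuousOn b C) (hb : ∀ x ∈ O, ContDiffAt ℝ 2 b x) (σ : ℝ) (α : Fin m) :
    ∃ t ∈ Icc 0 t₀, ∃ x ∈ C,
      (∀ s ∈ Icc 0 t₀, ∀ y ∈ C, σ * f s y α - b y ≤ σ * f t x α - b x) ∧
      (x ∉ O ∨ f t x = ψ x ∨ (ContDiffAt ℝ 2 (f t) x ∧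
        σ • fderiv ℝ (fun y => f t y α) x = fderiv ℝ b x ∧ 0 ≤ metricTrace (f t) b x)) := by
  have hcont : ContinuousOn (fun p : ℝ × E n => σ * f p.1 p.2 α - b p.2) (Icc 0 t₀ ×ˢ C) := by
    have h1 : ContinuousOn (fun p : ℝ × E n => f p.1 p.2 α) (Icc 0 t₀ ×ˢ C) :=
      (EuclideanSpace.proj (𝕜 := ℝ) α).continuous.comp_continuousOn
        (hf.continuousOn.mono (prod_mono subset_rfl hCΩ))
    exact (continuousOn_const.mul h1).sub (hbc.comp continuousOn_snd fun p hp => hp.2)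
  obtain ⟨⟨t, x⟩, ⟨ht, hx⟩, hmax⟩ := (isCompact_Icc.prod hC).exists_isMaxOn
    ((nonempty_Icc.2 ht₀).prod hCne) hcont
  have hmax' : ∀ s ∈ Icc 0 t₀, ∀ y ∈ C, σ * f s y α - b y ≤ σ * f t x α - b x :=
    fun s hs y hy => hmax (mk_mem_prod hs hy)
  refine ⟨t, ht, x, hx, hmax', ?_⟩
  by_cases hxO : x ∈ O
  · right
    rcases hf.interior t ht x (hOΩ hxO) with h | ⟨hc, hop⟩
    · exact Or.inl h
    right
    have hfα : ContDiffAt ℝ 2 (fun y => f t y α) x :=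
      (EuclideanSpace.proj (𝕜 := ℝ) α).contDiff.contDiffAt.comp x hc
    have hbx := hb x hxO
    have hloc : IsLocalMax (fun y => σ * f t y α - b y) x := by
      filter_upwards [hO.mem_nhds hxO] with y hy using hmax' t ht y (hOC hy)
    have hσf : ContDiffAt ℝ 2 (fun y => σ * f t y α) x := contDiffAt_const.mul hfα
    refine ⟨hc, ?_, ?_⟩
    · have h0 := hloc.fderiv_eq_zero
      rw [fderiv_fun_sub (hσf.differentiableAt (by norm_num)) (hbx.differentiableAt (by norm_num)),
        sub_eq_zero, fderiv_const_mul (hfα.differentiableAt (by norm_num))] at h0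
      exact h0
    · have h1 := metricTrace_nonpos_of_isLocalMax (hc.differentiableAt (by norm_num))
        (hσf.sub hbx) hloc
      rw [metricTrace_const_mul_sub σ hfα hbx] at h1
      have h2 := hop α σ fun s hs => by linarith [hmax' s hs x hx]
      have h3 : graphOperator (f t) α x = metricTrace (f t) (fun y => f t y α) x := rfl
      rw [h3] at h2
      linarith
  · exact Or.inl hxO

/-- Solutions stay within the oscillation of their boundary and initial values. -/
theorem IsWeakFlow.sub_le {t₀ : ℝ} {f : ℝ → E n → E m} (hf : IsWeakFlow Ω t₀ ψ f)
    (hn : 0 < n) (hopen : IsOpen Ω) (hbdd : Bornology.IsBounded Ω) (hne : Ω.Nonempty)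
    (ht₀ : 0 ≤ t₀) (σ : ℝ) (α : Fin m) {A : ℝ}
    (hψ : ContinuousOn (fun x => ψ x α) (closure Ω))
    (hA : ∀ x ∈ Ω, ∀ y ∈ Ω, σ * (ψ x α - ψ y α) ≤ A) {s : ℝ} (hs : s ∈ Icc 0 t₀) {y : E n}
    (hy : y ∈ Ω) : σ * (f s y α - ψ y α) ≤ A := by
  have hcompact : IsCompact (closure Ω) := hbdd.isCompact_closure
  obtain ⟨R, hR⟩ := hcompact.isBounded.exists_norm_le
  have hA' : ∀ x ∈ closure Ω, σ * (ψ x α - ψ y α) ≤ A := fun x hx =>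
    le_on_closure (f := fun x => σ * (ψ x α - ψ y α)) (g := fun _ => A)
      (fun x hx => hA x hx y hy) (continuousOn_const.mul (hψ.sub continuousOn_const))
      continuousOn_const hx
  have hε : ∀ ε > 0, σ * (f s y α - ψ y α) ≤ A + ε * R ^ 2 := by
    intro ε hε
    -- Since g^{ij}b_ij < 0 for this b, the maximum of σf + ε|y|² can only sit where f has its
    -- prescribed value ψ.
    obtain ⟨t, ht, x, hx, hmax, hcase⟩ := hf.exists_touching ht₀ hcompact hne.closure subset_rfl
      hopen subset_closure subset_rfl (b := fun y => -ε * ‖y‖ ^ 2) (by fun_prop)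
      (fun x _ => contDiffAt_norm_sq_mul _ x) σ α
    have hval : f t x = ψ x := by
      rcases hcase with h | h | ⟨hc, -, h⟩
      · exact hf.boundary t ht x (by rw [hopen.frontier_eq]; exact ⟨hx, h⟩)
      · exact h
      · exact absurd h (metricTrace_norm_sq_neg hn (hc.differentiableAt (by norm_num)) hε).not_ge
    have h1 := hmax s hs y (subset_closure hy)
    rw [hval] at h1
    have h2 := hA' x hx
    have h3 : ‖x‖ ^ 2 ≤ R ^ 2 := pow_le_pow_left₀ (norm_nonneg _) (hR x hx) 2
    have h4 := mul_le_mul_of_nonneg_left h3 hε.le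
    have h5 : 0 ≤ ε * ‖y‖ ^ 2 := by positivity
    simp only at h1
    linarith
  have hlim : Tendsto (fun ε : ℝ => A + ε * R ^ 2) (𝓝[>] 0) (𝓝 A) := by
    have hc : ContinuousAt (fun ε : ℝ => A + ε * R ^ 2) 0 := by fun_prop
    simpa [ContinuousAt] using hc.tendsto.mono_left nhdsWithin_le_nhds
  exact ge_of_tendsto hlim (by filter_upwards [self_mem_nhdsWithin] with ε h using hε ε h)

end Comparison

/-! ### Derivatives at the boundary -/

section BoundaryDerivative

variable {n : ℕ} {Ω : Set (E n)} {p : E n}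

/-- Continuity gives ρ ≥ 0 at a point of the closure, and ρ grows to first order along h. -/
theorem eventually_mem_of_fderiv_pos {U : Set (E n)} {ρ : E n → ℝ}
    (hρ : IsLocalDefiningFunction Ω U ρ p) (hp : p ∈ closure Ω) {h : E n}
    (hh : 0 < fderiv ℝ ρ p h) : ∀ᶠ t : ℝ in 𝓝[>] 0, p + t • h ∈ Ω := by
  have hU : U ∈ 𝓝 p := hρ.isOpen.mem_nhds hρ.mem
  have hC : ContDiffAt ℝ 2 ρ p := hρ.contDiffOn.contDiffAt hU
  have hρ0 : 0 ≤ ρ p := by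
    by_contra! hneg
    obtain ⟨y, ⟨hy1, hy2⟩, hyΩ⟩ := mem_closure_iff_nhds.1 hp _
      (inter_mem hU (hC.continuousAt.eventually_lt_const hneg))
    exact absurd ((hρ.mem_iff y hy1).1 hyΩ) (not_lt.2 hy2.le)
  have hcurve : HasDerivAt (fun t : ℝ => p + t • h) h 0 := by
    simpa using ((hasDerivAt_id (0 : ℝ)).smul_const h).const_add p
  have hd0 : HasFDerivAt ρ (fderiv ℝ ρ p) (p + (0 : ℝ) • h) := by
    simpa using (hC.differentiableAt (by norm_num)).hasFDerivAt
  have h1 := (hd0.comp_hasDerivAt 0 hcurve).tendsto_slope_zero_right.eventually_const_lt hh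
  have h2 : ∀ᶠ t : ℝ in 𝓝[>] 0, p + t • h ∈ U := by
    have hc : ContinuousAt (fun t : ℝ => p + t • h) 0 := by fun_prop
    have : Tendsto (fun t : ℝ => p + t • h) (𝓝[>] 0) (𝓝 p) := by
      simpa [ContinuousAt] using hc.tendsto.mono_left nhdsWithin_le_nhds
    exact this hU
  filter_upwards [h1, h2, self_mem_nhdsWithin] with t ht1 ht2 ht0
  have ht0' : 0 < t := ht0
  refine (hρ.mem_iff _ ht2).2 ?_
  simp only [Function.comp_apply, zero_add, zero_smul, add_zero, smul_eq_mul] at ht1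
  have := (mul_pos_iff_of_pos_left (inv_pos.2 ht0')).1 ht1
  linarith

/-- A function that vanishes at a boundary point and grows at most linearly has a small one-sided
derivative there. -/
theorem norm_le_of_hasFDerivWithinAt (hC2 : HasC2Boundary Ω) (hp : p ∈ frontier Ω)
    {F : E n → ℝ} {M : E n →L[ℝ] ℝ} (hF : HasFDerivWithinAt F M (closure Ω) p) (hF0 : F p = 0)
    {C : ℝ} (hC : 0 ≤ C) (hFC : ∀ᶠ y in 𝓝[Ω] p, |F y| ≤ C * dist y p) : ‖M‖ ≤ C := by
  obtain ⟨U, ρ, hρ⟩ := hC2 p hp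
  have hpc := frontier_subset_closure hp
  have hpos : ∀ h : E n, 0 < fderiv ℝ ρ p h → |M h| ≤ C * ‖h‖ := by
    intro h hh
    have hin := eventually_mem_of_fderiv_pos hρ hpc hh
    have hlim := hF.lim (l := 𝓝[>] (0 : ℝ)) (c := fun t => t⁻¹) (d := fun t => t • h) (v := h)
      (by
        have hc : ContinuousAt (fun t : ℝ => t • h) 0 := by fun_prop
        simpa [ContinuousAt] using hc.tendsto.mono_left nhdsWithin_le_nhds)
      (hin.mono fun t ht => subset_closure ht)
      (tendsto_const_nhds.congr' (by
        filter_upwards [self_mem_nhdsWithin] with t ht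
        rw [inv_smul_smul₀ (ne_of_gt ht)]))
    refine le_of_tendsto hlim.abs ?_
    have htend : Tendsto (fun t : ℝ => p + t • h) (𝓝[>] 0) (𝓝[Ω] p) := by
      refine tendsto_nhdsWithin_iff.2 ⟨?_, hin⟩
      have hc : ContinuousAt (fun t : ℝ => p + t • h) 0 := by fun_prop
      simpa [ContinuousAt] using hc.tendsto.mono_left nhdsWithin_le_nhds
    filter_upwards [htend.eventually hFC, self_mem_nhdsWithin] with t ht ht0
    have ht0' : 0 < t := ht0
    rw [dist_eq_norm, add_sub_cancel_left, norm_smul, Real.norm_of_nonneg ht0'.le] at ht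
    rw [hF0, sub_zero, smul_eq_mul, abs_mul, abs_of_pos (inv_pos.2 ht0')]
    calc t⁻¹ * |F (p + t • h)| ≤ t⁻¹ * (C * (t * ‖h‖)) := by gcongr
      _ = C * ‖h‖ := by field_simp
  obtain ⟨v, hv⟩ : ∃ v, 0 < fderiv ℝ ρ p v := by
    by_contra! hle
    refine hρ.regular p hρ.mem ?_
    ext w
    have h1 := hle w
    have h2 := hle (-w)
    rw [map_neg] at h2
    exact le_antisymm h1 (by simpa using h2)
  -- Directions tangent to the boundary are limits of inward ones; up to sign this covers all
  -- directions.
  have hnonneg : ∀ h : E n, 0 ≤ fderiv ℝ ρ p h → |M h| ≤ C * ‖h‖ := by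
    intro h hh
    have h1 : Tendsto (fun t : ℝ => |M (h + t • v)|) (𝓝[>] 0) (𝓝 |M h|) := by
      have hc : ContinuousAt (fun t : ℝ => |M (h + t • v)|) 0 := by fun_prop
      simpa [ContinuousAt] using hc.tendsto.mono_left nhdsWithin_le_nhds
    have h2 : Tendsto (fun t : ℝ => C * ‖h + t • v‖) (𝓝[>] 0) (𝓝 (C * ‖h‖)) := by
      have hc : ContinuousAt (fun t : ℝ => C * ‖h + t • v‖) 0 := by fun_prop
      simpa [ContinuousAt] using hc.tendsto.mono_left nhdsWithin_le_nhds
    refine le_of_tendsto_of_tendsto h1 h2 ?_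
    filter_upwards [self_mem_nhdsWithin] with t ht
    have ht0 : 0 < t := ht
    refine hpos _ ?_
    rw [map_add, map_smul, smul_eq_mul]
    positivity
  refine M.opNorm_le_bound hC fun h => ?_
  rw [Real.norm_eq_abs]
  rcases le_total 0 (fderiv ℝ ρ p h) with hh | hh
  · exact hnonneg h hh
  · have := hnonneg (-h) (by rw [map_neg]; linarith)
    simpa using this

/-- A function of class `C²` up to the boundary has a one-sided derivative at boundary points that
is bounded by the supremum of the gradient. -/
theorem exists_hasFDerivWithinAt_norm_le (hopen : IsOpen Ω) {φ : E n → ℝ}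
    (hφ : ContDiffOn ℝ 2 φ (closure Ω)) {K : ℝ} (hK : ∀ x ∈ Ω, ‖fderiv ℝ φ x‖ ≤ K)
    (hp : p ∈ closure Ω) :
    ∃ P : E n →L[ℝ] ℝ, HasFDerivWithinAt φ P (closure Ω) p ∧ ‖P‖ ≤ K := by
  obtain ⟨f', hP, hc, hd⟩ := exists_fderiv_extension hopen hp (k := 1) (by
    have := hφ p hp
    norm_num
    exact this)
  refine ⟨f' p, hP, ?_⟩
  have : (𝓝[Ω] p).NeBot := mem_closure_iff_nhdsWithin_neBot.1 hp
  refine le_of_tendsto (hc.continuousWithinAt.mono subset_closure).norm ?_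
  filter_upwards [hd, self_mem_nhdsWithin] with y hy hyΩ
  rw [← hy.fderiv]
  exact hK y hyΩ

end BoundaryDerivative

/-! ### The boundary gradient estimate -/

section BoundaryGradient

variable {n k : ℕ} {Ω : Set (E n)} {ψ : E n → E (k + 1)} {l d₀ K ν κ : ℝ}

theorem contDiffOn_component {s : Set (E n)} (hψ : ContDiffOn ℝ 2 ψ s) (α : Fin (k + 1)) :
    ContDiffOn ℝ 2 (fun x => ψ x α) s :=
  (EuclideanSpace.proj (𝕜 := ℝ) α).contDiff.comp_contDiffOn hψ

theorem collar_compl {x : E n} (hx : x ∈ closure Ω) (hxd : bdist Ω x ≤ d₀)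
    (hxO : x ∉ collar Ω d₀) (hopen : IsOpen Ω) :
    x ∈ frontier Ω ∨ (x ∈ Ω ∧ bdist Ω x = d₀) := by
  by_cases hxΩ : x ∈ Ω
  · exact Or.inr ⟨hxΩ, le_antisymm hxd (not_lt.1 fun h => hxO ⟨hxΩ, h⟩)⟩
  · exact Or.inl (by rw [hopen.frontier_eq]; exact ⟨hx, hxΩ⟩)

/-- The bound on the differential of the graph by the slope of the barrier in the part of the
domain away from the boundary. -/
theorem one_add_sq_singularValues_le (hn : 2 ≤ n) {u : E n → E (k + 1)} {x : E n}
    (hu : DifferentiableAt ℝ u x)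
    (hgrad : ∀ α : Fin k, ‖fderiv ℝ (fun y => u y α.castSucc) x‖ ≤ ((n : ℝ) - 1) / k)
    {p : ℝ} (hK : 0 ≤ K) (hp : n * (1 + K) ≤ p)
    (hlast : ‖fderiv ℝ (fun y => u y (Fin.last k)) x‖ ≤ p + K) (i : Fin n) :
    1 + (fderiv ℝ u x).toLinearMap.singularValues i ^ 2 ≤ 8 * p ^ 2 := by
  have hn' : (2 : ℝ) ≤ n := by exact_mod_cast hn
  have h1 := sq_singularValues_le_sum hu i
  rw [Fin.sum_univ_castSucc] at h1
  have h2 : ∑ α : Fin k, ‖fderiv ℝ (fun y => u y α.castSucc) x‖ ^ 2 ≤ ((n : ℝ) - 1) ^ 2 := by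
    calc _ ≤ ∑ _α : Fin k, (((n : ℝ) - 1) / k) ^ 2 :=
          Finset.sum_le_sum fun α _ => pow_le_pow_left₀ (norm_nonneg _) (hgrad α) 2
      _ = k * (((n : ℝ) - 1) / k) ^ 2 := by simp
      _ ≤ ((n : ℝ) - 1) ^ 2 := by
          -- For a single component the quotient by k is 0 by convention, and the sum is empty.
          rcases Nat.eq_zero_or_pos k with rfl | hk
          · simp only [Nat.cast_zero, zero_mul]
            positivity
          · have hk' : (1 : ℝ) ≤ k := by exact_mod_cast hk
            have : k * (((n : ℝ) - 1) / k) ^ 2 = ((n : ℝ) - 1) ^ 2 / k := by field_simp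
            rw [this]
            exact div_le_self (sq_nonneg _) hk'
  have h3 := pow_le_pow_left₀ (norm_nonneg _) hlast 2
  -- With n ≤ p and K ≤ p: 1 + (n-1)² ≤ n² ≤ p² and (p + K)² ≤ 4p², a total of at most 5p².
  have hnp : (n : ℝ) ≤ p := by nlinarith
  have hKp : K ≤ p := by nlinarith
  nlinarith

/-- The last component differs from the data by at most the barrier in the collar. -/
theorem IsWeakFlow.sub_le_logBarrier (hn : 2 ≤ n) (hopen : IsOpen Ω)
    (hne : (frontier Ω).Nonempty) (hΩne : Ω.Nonempty) (hbdd : Bornology.IsBounded Ω)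
    (hC2 : HasC2Boundary Ω) (hmean : MeanConvex Ω) (hψ : ContDiffOn ℝ 2 ψ (closure Ω))
    (hl : intrinsicDiam Ω ≤ ENNReal.ofReal l) (hd₀ : 0 < d₀)
    (hd : ContDiffOn ℝ 2 (bdist Ω) (closure (collar Ω d₀)))
    (hK : K = gradSup Ω (lastComp ψ)) (hν : ν = nu Ω d₀ (lastComp ψ))
    (hκ : κ = kappa Ω l d₀ (lastComp ψ))
    (hsmall : max ((64 * (1 + K) ^ 2 * κ ^ 2 + 8 * n) * lamMinus Ω d₀) (2 * n * ν * (1 + K))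
      ≤ 1 / d₀)
    {t₀ : ℝ} (ht₀ : 0 ≤ t₀) {f : ℝ → E n → E (k + 1)} (hf : IsWeakFlow Ω t₀ ψ f)
    (harea : ∀ t ∈ Icc 0 t₀, AreaDecreasing Ω (f t))
    (hgrad : ∀ t ∈ Icc 0 t₀, ∀ x ∈ innerPart Ω (d₀ / κ), ∀ α : Fin k,
      ‖fderiv ℝ (fun y => f t y α.castSucc) x‖ ≤ ((n : ℝ) - 1) / k)
    (hdet : ∀ t ∈ Icc 0 t₀, ∀ x ∈ Ω, (metric (f t) x).det ≤ 2 * κ ^ 2 / (d₀ ^ 2 * ν ^ 2))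
    {σ : ℝ} (hσ : σ = 1 ∨ σ = -1) {s : ℝ} (hs : s ∈ Icc 0 t₀) {y : E n} (hy : y ∈ closure Ω)
    (hyd : bdist Ω y ≤ d₀) :
    σ * (lastComp (f s) y - lastComp ψ y) ≤ logBarrier ν κ d₀ (bdist Ω y) := by
  have hn' : (2 : ℝ) ≤ n := by exact_mod_cast hn
  have hσ1 : |σ| = 1 := by rcases hσ with rfl | rfl <;> simp
  have hφ : ContDiffOn ℝ 2 (lastComp ψ) (closure Ω) := contDiffOn_component hψ _
  have hK0 : 0 ≤ K := hK ▸ gradSup_nonneg _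
  have hl0 : 0 ≤ l := nonneg_of_intrinsicDiam_le (by omega) hopen hΩne hl
  set Λ := max (lamPlus Ω d₀ (lastComp ψ)) (lamPlus Ω d₀ fun x => -lastComp ψ x) with hΛ
  have hΛ0 : 0 ≤ Λ := le_max_of_le_left (le_max_left _ _)
  have hνΛ : ν = 16 * n * (Λ + 1) := hν
  have hν0 : 0 < ν := by rw [hνΛ]; positivity
  have hκe : κ = Real.exp (ν * (K * l)) := by rw [hκ, kappa, ← hν, ← hK, mul_assoc]
  have hκ1 : 1 ≤ κ := by rw [hκe]; exact Real.one_le_exp (by positivity)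
  have hκ0 : 0 < κ := by linarith
  have hgradφ : ∀ x ∈ Ω, ‖fderiv ℝ (lastComp ψ) x‖ ≤ K := fun x hx =>
    hK ▸ norm_fderiv_le_gradSup hopen hbdd hφ hx
  have hφx : ∀ x ∈ Ω, ContDiffAt ℝ 2 (lastComp ψ) x := fun x hx =>
    contDiffAt_of_closure hopen hφ hx
  have hcol := isOpen_collar hopen d₀
  have hσφ : ∀ x ∈ Ω, ContDiffAt ℝ 2 (fun y => σ * lastComp ψ y) x := fun x hx =>
    contDiffAt_const.mul (hφx x hx)
  have hbound : ∀ s ∈ Icc 0 t₀, ∀ y ∈ Ω, σ * (lastComp (f s) y - lastComp ψ y) ≤ K * l := by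
    intro s hs y hy
    refine hf.sub_le (by omega) hopen hbdd hΩne ht₀ σ (Fin.last k) hφ.continuousOn ?_ hs hy
    intro x hx z hz
    have h := abs_sub_le_mul_intrinsicDiam hopen (fun x hx =>
      (hφx x hx).differentiableAt (by norm_num)) hgradφ hK0 hl hz hx
    rw [max_eq_left hl0] at h
    calc σ * (lastComp ψ x - lastComp ψ z) ≤ |σ * (lastComp ψ x - lastComp ψ z)| := le_abs_self _
      _ ≤ K * l := by rwa [abs_mul, hσ1, one_mul]
  -- Both follow from νv' ≥ 1/(2d₀) and the smallness of d₀; for the second, half of 8n λ₋ is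
  -- already at least 2(n+1) λ₋.
  have hslope : ∀ x, bdist Ω x ≤ d₀ →
      n * (1 + K) ≤ logBarrierSlope ν κ d₀ (bdist Ω x) ∧
      2 * (n + 1) * lamMinus Ω d₀ ≤ ν * logBarrierSlope ν κ d₀ (bdist Ω x) := by
    intro x hx
    have h1 := one_div_le_logBarrierSlope hν0 hκ1 hd₀ bdist_nonneg hx
    have h2 : 1 / (2 * d₀) = 1 / d₀ / 2 := by field_simp
    rw [h2] at h1
    have h3 := (le_max_left _ _).trans hsmall
    have h4 := (le_max_right _ _).trans hsmall
    have hlam : 0 ≤ lamMinus Ω d₀ := le_max_left _ _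
    constructor
    · refine le_of_mul_le_mul_left ?_ hν0
      linarith
    · have h5 : 0 ≤ 64 * (1 + K) ^ 2 * κ ^ 2 * lamMinus Ω d₀ := by positivity
      nlinarith
  set b : E n → ℝ := fun y => logBarrier ν κ d₀ (bdist Ω y) + σ * lastComp ψ y with hb
  have hbC : ∀ x ∈ collar Ω d₀, ContDiffAt ℝ 2 b x := fun x hx =>
    ((contDiffAt_logBarrier hκ0 hd₀ bdist_nonneg).comp x
      (contDiffAt_of_closure hcol hd hx)).add (hσφ x hx.1)
  set C := closure Ω ∩ {x | bdist Ω x ≤ d₀} with hC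
  have hCcompact : IsCompact C := hbdd.isCompact_closure.inter_right
    (isClosed_le bdist_lipschitz.continuous continuous_const)
  have hbcont : ContinuousOn b C := by
    refine ContinuousOn.add (fun x _ => ?_) (continuousOn_const.mul
      (hφ.continuousOn.mono inter_subset_left))
    have h1 : ContinuousAt (logBarrier ν κ d₀) (bdist Ω x) :=
      (contDiffAt_logBarrier hκ0 hd₀ bdist_nonneg).continuousAt
    exact (h1.comp bdist_lipschitz.continuous.continuousAt).continuousWithinAt
  obtain ⟨t, ht, x, hx, hmax, hcase⟩ := hf.exists_touching ht₀ hCcompact ⟨y, hy, hyd⟩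
    inter_subset_left hcol (fun x hx => ⟨subset_closure hx.1, hx.2.le⟩) (collar_subset d₀)
    hbcont hbC σ (Fin.last k)
  have hle : σ * f t x (Fin.last k) - b x ≤ 0 := by
    have hvnn := logBarrier_nonneg hν0 hκ0 hd₀ (bdist_nonneg (Ω := Ω) (x := x))
    have hval : f t x = ψ x → σ * f t x (Fin.last k) - b x ≤ 0 := by
      intro h
      rw [h]
      simp only [hb, lastComp]
      linarith
    by_cases hxO : x ∈ collar Ω d₀
    swap
    · rcases collar_compl hx.1 hx.2 hxO hopen with h | ⟨hxΩ, hxd⟩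
      · exact hval (hf.boundary t ht x h)
      · have h1 := hbound t ht x hxΩ
        have h2 := le_logBarrier_self hν0 hd₀ hκe
        simp only [hb, hxd, lastComp] at h1 ⊢
        linarith
    rcases hcase with h | h | ⟨hc, hD, htr⟩
    · exact absurd hxO h
    · exact hval h
    exfalso
    have hdx := contDiffAt_of_closure hcol hd hxO
    have hu : DifferentiableAt ℝ (f t) x := hc.differentiableAt (by norm_num)
    have hsx : 0 < d₀ + κ * bdist Ω x := by
      have := bdist_nonneg (Ω := Ω) (x := x)
      positivity
    have hv : ∀ᶠ s in 𝓝 (bdist Ω x),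
        HasDerivAt (logBarrier ν κ d₀) (logBarrierSlope ν κ d₀ s) s := by
      have hcont : ContinuousAt (fun s => d₀ + κ * s) (bdist Ω x) := by fun_prop
      filter_upwards [hcont.eventually_const_lt hsx] with s hs
        using hasDerivAt_logBarrier hν0 hκ0 hd₀ hs
    set p := logBarrierSlope ν κ d₀ (bdist Ω x) with hp
    have hp0 : 0 < p := logBarrierSlope_pos hν0 hκ0 hd₀ bdist_nonneg
    -- At the touching point the gradient of the last component is, up to sign, that of the barrier.
    have hlast : ‖fderiv ℝ (fun y => f t y (Fin.last k)) x‖ ≤ p + K := by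
      obtain ⟨N, hN, hdN, -, -⟩ := exists_normal_bdist hopen hne hC2 hmean hxO.1 hdx
      have hdb : fderiv ℝ b x = p • innerSL ℝ N + σ • fderiv ℝ (lastComp ψ) x := by
        rw [← hdN]
        exact ((hv.self_of_nhds.comp_hasFDerivAt x
          (hdx.differentiableAt (by norm_num)).hasFDerivAt).add
          (((hφx x hxO.1).differentiableAt (by norm_num)).hasFDerivAt.const_mul σ)).fderiv
      have h1 := congrArg norm hD
      rw [norm_smul, Real.norm_eq_abs, hσ1, one_mul, hdb] at h1
      rw [h1]
      refine (norm_add_le _ _).trans (add_le_add ?_ ?_)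
      · rw [norm_smul, innerSL_apply_norm, hN, mul_one, Real.norm_of_nonneg hp0.le]
      · rw [norm_smul, Real.norm_eq_abs, hσ1, one_mul]
        exact hgradφ x hxO.1
    have hcc : closure (collar Ω d₀) ⊆ closure Ω := closure_mono (collar_subset d₀)
    have hφΛ : ∀ w, D2 (fun y => σ * lastComp ψ y) x w w ≤ Λ * ‖w‖ ^ 2 := by
      intro w
      rcases hσ with rfl | rfl
      · simp only [one_mul]
        exact (D2_le_lamPlus hopen hbdd (hφ.mono hcc) hxO w).trans
          (mul_le_mul_of_nonneg_right (le_max_left _ _) (sq_nonneg _))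
      · simp only [neg_one_mul]
        exact (D2_le_lamPlus hopen hbdd (hφ.mono hcc).neg hxO w).trans
          (mul_le_mul_of_nonneg_right (le_max_right _ _) (sq_nonneg _))
    have hsv : ∀ i : Fin n, 1 + (fderiv ℝ (f t) x).toLinearMap.singularValues i ^ 2 ≤
        8 * p ^ 2 := by
      intro i
      -- The distance d₀/κ is where the determinant bound stops being dominated by 8v'² and the
      -- gradient bounds take over.
      rcases le_or_gt (bdist Ω x) (d₀ / κ) with hnear | hfar
      · exact ((one_add_sq_singularValues_le_det hu i).trans (hdet t ht x hxO.1)).trans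
          (le_logBarrierSlope_near hν0 hκ1 hd₀ bdist_nonneg hnear)
      · exact one_add_sq_singularValues_le hn hu (hgrad t ht x ⟨hxO.1, hfar⟩) hK0
          (hslope x hx.2).1 hlast i
    exact htr.not_gt (metricTrace_barrier_neg hn hopen hne hC2 hmean hxO.1 hdx
      (le_max_left _ _) (neg_lamMinus_le_D2 hopen hbdd hd hxO) (hσφ x hxO.1) hΛ0 hφΛ hu
      (harea t ht x hxO.1) hνΛ hv (hasDerivAt_logBarrierSlope hν0 hsx)
      (contDiffAt_logBarrier hκ0 hd₀ bdist_nonneg) hp0 (hslope x hx.2).2 hsv)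
  have h := hmax s hs y ⟨hy, hyd⟩
  simp only [hb, lastComp] at h hle ⊢
  linarith

/-- The boundary gradient estimate for the last component. -/
theorem IsWeakFlow.norm_boundary_derivative_le (hn : 2 ≤ n) (hopen : IsOpen Ω)
    (hΩne : Ω.Nonempty) (hbdd : Bornology.IsBounded Ω)
    (hC2 : HasC2Boundary Ω) (hmean : MeanConvex Ω) (hψ : ContDiffOn ℝ 2 ψ (closure Ω))
    (hl : intrinsicDiam Ω ≤ ENNReal.ofReal l) (hd₀ : 0 < d₀)
    (hd : ContDiffOn ℝ 2 (bdist Ω) (closure (collar Ω d₀)))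
    (hK : K = gradSup Ω (lastComp ψ)) (hν : ν = nu Ω d₀ (lastComp ψ))
    (hκ : κ = kappa Ω l d₀ (lastComp ψ))
    (hsmall : max ((64 * (1 + K) ^ 2 * κ ^ 2 + 8 * n) * lamMinus Ω d₀) (2 * n * ν * (1 + K))
      ≤ 1 / d₀)
    {t₀ : ℝ} (ht₀ : 0 ≤ t₀) {f : ℝ → E n → E (k + 1)} (hf : IsWeakFlow Ω t₀ ψ f)
    (harea : ∀ t ∈ Icc 0 t₀, AreaDecreasing Ω (f t))
    (hgrad : ∀ t ∈ Icc 0 t₀, ∀ x ∈ innerPart Ω (d₀ / κ), ∀ α : Fin k,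
      ‖fderiv ℝ (fun y => f t y α.castSucc) x‖ ≤ ((n : ℝ) - 1) / k)
    (hdet : ∀ t ∈ Icc 0 t₀, ∀ x ∈ Ω, (metric (f t) x).det ≤ 2 * κ ^ 2 / (d₀ ^ 2 * ν ^ 2))
    {s : ℝ} (hs : s ∈ Icc 0 t₀) {p : E n} (hp : p ∈ frontier Ω) {L : E n →L[ℝ] ℝ}
    (hL : HasFDerivWithinAt (lastComp (f s)) L (closure Ω) p) : ‖L‖ ≤ κ / (d₀ * ν) + K := by
  have hφ : ContDiffOn ℝ 2 (lastComp ψ) (closure Ω) := contDiffOn_component hψ _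
  have hν0 : 0 < ν := by
    rw [hν, nu]
    have : 0 ≤ max (lamPlus Ω d₀ (lastComp ψ)) (lamPlus Ω d₀ fun x => -lastComp ψ x) :=
      le_max_of_le_left (le_max_left _ _)
    positivity
  have hκ0 : 0 < κ := by rw [hκ]; exact Real.exp_pos _
  obtain ⟨P, hP, hPK⟩ := exists_hasFDerivWithinAt_norm_le hopen hφ
    (fun x hx => norm_fderiv_le_gradSup hopen hbdd hφ hx) (frontier_subset_closure hp)
  have hC0 : 0 ≤ κ / (d₀ * ν) := by positivity
  -- The difference from φ vanishes at p and is at most v(d) ≤ v'(0) d, hence at most v'(0) times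
  -- the distance to p.
  have hM := norm_le_of_hasFDerivWithinAt hC2 hp (hL.sub hP)
    (by simp [lastComp, hf.boundary s hs p hp]) hC0 (by
      have h1 : ∀ᶠ y in 𝓝[Ω] p, y ∈ Metric.ball p d₀ :=
        mem_nhdsWithin_of_mem_nhds (Metric.ball_mem_nhds p hd₀)
      filter_upwards [h1, self_mem_nhdsWithin] with y hy hyΩ
      have hyd : bdist Ω y ≤ d₀ := (bdist_le_dist hp y).trans (Metric.mem_ball.1 hy).le
      have hlog := logBarrier_le hν0 hκ0 hd₀ (bdist_nonneg (Ω := Ω) (x := y))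
      have hdist := mul_le_mul_of_nonneg_left (bdist_le_dist hp y) hC0
      have hkey : ∀ σ : ℝ, σ = 1 ∨ σ = -1 →
          σ * (lastComp (f s) y - lastComp ψ y) ≤ logBarrier ν κ d₀ (bdist Ω y) := fun σ hσ =>
        hf.sub_le_logBarrier hn hopen ⟨p, hp⟩ hΩne hbdd hC2 hmean hψ hl hd₀ hd hK hν hκ hsmall ht₀
          harea hgrad hdet hσ hs (subset_closure hyΩ) hyd
      have h2 := hkey 1 (Or.inl rfl)
      have h3 := hkey (-1) (Or.inr rfl)
      rw [Pi.sub_apply]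
      exact abs_le.2 ⟨by linarith, by linarith⟩)
  calc ‖L‖ = ‖(L - P) + P‖ := by rw [sub_add_cancel]
    _ ≤ ‖L - P‖ + ‖P‖ := norm_add_le _ _
    _ ≤ κ / (d₀ * ν) + K := add_le_add hM (hK ▸ hPK)

end BoundaryGradient

end MinimalGraph
theorem mainTheorem7 (n k : ℕ) (hn : 2 ≤ n) (Ω : Set (E n))
    (hopen : IsOpen Ω) (hconn : IsConnected Ω) (hbdd : Bornology.IsBounded Ω)
    (hC2 : HasC2Boundary Ω) (hmean : MeanConvex Ω)
    (ψ : E n → E (k + 1)) (hψ : ContDiffOn ℝ 2 ψ (closure Ω))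
    (l : ℝ) (hl : intrinsicDiam Ω ≤ ENNReal.ofReal l)
    (d₀ : ℝ) (hd₀ : 0 < d₀) (hd : ContDiffOn ℝ 2 (bdist Ω) (closure (collar Ω d₀)))
    (K ν κ : ℝ) (hK : K = gradSup Ω (lastComp ψ)) (hν : ν = nu Ω d₀ (lastComp ψ))
    (hκ : κ = kappa Ω l d₀ (lastComp ψ))
    (hsmall : max ((64 * (1 + K) ^ 2 * κ ^ 2 + 8 * n) * lamMinus Ω d₀) (2 * n * ν * (1 + K))
      ≤ 1 / d₀) :
    -- the elliptic estimate
    (∀ u : E n → E (k + 1), IsMinimalGraph Ω ψ u → AreaDecreasing Ω u →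
      (∀ x ∈ innerPart Ω (d₀ / κ), ∀ α : Fin k,
        ‖fderiv ℝ (fun y => u y α.castSucc) x‖ ≤ ((n : ℝ) - 1) / k) →
      (∀ x ∈ Ω, (metric u x).det ≤ 2 * κ ^ 2 / (d₀ ^ 2 * ν ^ 2)) →
      ∀ x ∈ frontier Ω, ∀ L : E n →L[ℝ] ℝ,
        HasFDerivWithinAt (lastComp u) L (closure Ω) x → ‖L‖ ≤ κ / (d₀ * ν) + K) ∧
    -- the parabolic estimate
    (∀ (T : ℝ) (f : ℝ → E n → E (k + 1)), IsGraphFlow Ω T ψ f →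
      (∀ t ∈ Set.Ico 0 T, AreaDecreasing Ω (f t)) →
      (∀ t ∈ Set.Ico 0 T, ∀ x ∈ innerPart Ω (d₀ / κ), ∀ α : Fin k,
        ‖fderiv ℝ (fun y => f t y α.castSucc) x‖ ≤ ((n : ℝ) - 1) / k) →
      (∀ t ∈ Set.Ico 0 T, ∀ x ∈ Ω, (metric (f t) x).det ≤ 2 * κ ^ 2 / (d₀ ^ 2 * ν ^ 2)) →
      ∀ t ∈ Set.Ico 0 T, ∀ x ∈ frontier Ω, ∀ L : E n →L[ℝ] ℝ,
        HasFDerivWithinAt (lastComp (f t)) L (closure Ω) x → ‖L‖ ≤ κ / (d₀ * ν) + K) := by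
  refine ⟨fun u hu harea hgrad hdet x hx L hL => ?_,
    fun T f hf harea hgrad hdet t ht x hx L hL => ?_⟩
  · exact (hu.isWeakFlow hopen).norm_boundary_derivative_le hn hopen hconn.nonempty hbdd hC2 hmean
      hψ hl hd₀ hd hK hν hκ hsmall le_rfl (fun _ _ => harea) (fun _ _ => hgrad) (fun _ _ => hdet)
      (left_mem_Icc.2 le_rfl) hx hL
  · have hsub : ∀ s ∈ Set.Icc 0 t, s ∈ Set.Ico 0 T := fun s hs => ⟨hs.1, hs.2.trans_lt ht.2⟩
    exact (hf.isWeakFlow hopen ht).norm_boundary_derivative_le hn hopen hconn.nonempty hbdd hC2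
      hmean hψ hl hd₀ hd hK hν hκ hsmall ht.1 (fun s hs => harea s (hsub s hs))
      (fun s hs => hgrad s (hsub s hs)) (fun s hs => hdet s (hsub s hs)) (right_mem_Icc.2 ht.1)
      hx hL
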